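/- **Setting.** Let $M=\langle\mathcal S,\mathcal A,r,c,H,P,\bar C\rangle$ be an episodic constrained MDP with finite state and action spaces, $S=|\mathcal S|$, $A=|\mathcal A|$, costs $r,c:\mathcal S\times\mathcal A\to[0,1]$, episode length $H$, transition kernel $P(s'|s,a)$ and fixed initial state $s^1$. A policy $\pi=(\pi^h)_{h=1}^H$ assigns to each step and state a probability vector over actions, and $V_l^\pi(P')=\mathbb E[\sum_{h=1}^H l(s^h,a^h)\mid \pi,P',s^1]$ for a cost $l$ and a model $P'$. A policy is safe if $V_c^\pi(P)\le\bar C$; $\pi^*$ minimizes $V_r^\pi(P)$ over all safe policies. A baseline policy $\pi_b$ with $V_c^{\pi_b}(P)=\bar C_b$ is known, where $\bar C_b<\bar C$ and $\bar C-\bar C_b\le H$. **Algorithm.** Fix $\delta\in(0,1)$, a number $K\ge 1$ of episodes, and $L=\log(2SAHK/\delta)$. Let $n_k(s,a)$ and $n_k(s,a,s')$ be the numbers of visits to $(s,a)$ and of transitions $(s,a,s')$ in episodes $1,\dots,k-1$, and put $\widehat P_k(s'|s,a)=\frac{n_k(s,a,s')}{n_k(s,a)\vee1}$, $$\beta_k(s,a,s')=\sqrt{\frac{4\widehat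 P_k(s'|s,a)(1-\widehat P_k(s'|s,a))L}{n_k(s,a)\vee1}}+\frac{14L}{3(n_k(s,a)\vee1)},\qquad \bar\beta_k(s,a)=\sum_{s'}\beta_k(s,a,s'),$$ $\mathcal P_k=\{P': |P'(s'|s,a)-\widehat P_k(s'|s,a)|\le\beta_k(s,a,s')\ \forall s,a,s'\}$ (a set of transition kernels), $c_k=c+H\bar\beta_k$ and $r_k=r-\frac{H^2}{\bar C-\bar C_b}\bar\beta_k$. OPSRL with parameter $K_o$ plays $\pi_k=\pi_b$ in the episodes $k\le K_o$; in an episode $k>K_o$ it plays $\pi_k$, where $(\pi_k,P_k)$ is a solution of the OP problem: minimize $V_{r_k}^{\pi'}(P')$ over policies $\pi'$ and $P'\in\mathcal P_k$ subject to $V_{c_k}^{\pi'}(P')\le\bar C$ (ties broken in any way; if the OP problem is infeasible, $\pi_k$ may be any policy determined by the past observations). Let $R(K)=\sum_{k=1}^K\big(V_r^{\pi_k}(P)-V_r^{\pi^*}(P)\big)$. **Theorem.** There are universal constants $c_0>0$ and $p_0\in\mathbb N$ such that for all $c_1\in\mathbb R$ and $p_1\in\mathbb N$ there are $C>0$ and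 $q\in\mathbb N$, depending only on $c_1,p_1$, for which the following holds for every instance as above. If $$c_0L^{p_0}\frac{S^2AH^3}{(\bar C-\bar C_b)^2}\le K_o\le c_1L^{p_1}\frac{S^2AH^3}{(\bar C-\bar C_b)^2},$$ and OPSRL is run with this $K_o$, then: 1. with probability at least $1-3\delta$, $(\pi_b,P)$ is feasible for the OP problem in every episode $k\in[K]$ with $k\ge K_o$; 2. with probability at least $1-3\delta$, $V_c^{\pi_k}(P)\le\bar C$ for all $k\in[K]$; 3. with probability at least $1-3\delta$, $$R(K)\le C\,L^q\left(\frac{S^2AH^4}{(\bar C-\bar C_b)^2}+\frac{S^2}{\bar C-\bar C_b}\sqrt{AH^7K}\right).$$ -/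

import Mathlib

namespace OPSRL

/-- A (stationary) model: `P s a` is the probability vector of the next state. -/
abbrev Model (S A : Type*) [Fintype S] := S → A → stdSimplex ℝ S

/-- A non-stationary randomized policy for episodes of length `H`: `π h s` is the probability
vector of the action taken at (zero-based) step `h` in state `s`. -/
abbrev Policy (S A : Type*) [Fintype A] (H : ℕ) := Fin H → S → stdSimplex ℝ A

/-- The observations of one episode: the states `s¹, …, s^{H+1}` and the actions `a¹, …, a^H`. -/
abbrev Episode (S A : Type*) (H : ℕ) := (Fin (H + 1) → S) × (Fin H → A)

/-- A finite-horizon constrained MDP with costs in `[0, 1]` and a fixed initial state. -/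
structure CMDP (S A : Type*) [Fintype S] where
  /-- the objective cost -/
  r : S → A → ℝ
  /-- the constraint cost -/
  c : S → A → ℝ
  /-- the true model -/
  P : Model S A
  /-- the initial state of every episode -/
  s₁ : S
  /-- the maximum permissible expected cumulative constraint cost -/
  Cbar : ℝ
  r_mem : ∀ s a, r s a ∈ Set.Icc (0 : ℝ) 1
  c_mem : ∀ s a, c s a ∈ Set.Icc (0 : ℝ) 1

section

set_option linter.unusedSectionVars false

variable {S A : Type*} [Fintype S] [Fintype A] [DecidableEq S] [DecidableEq A] {H : ℕ}

/-- The probability of the episode `x` when policy `π` is run in model `P` from state `s`. -/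
def episodeProb (π : Policy S A H) (P : Model S A) (s : S) (x : Episode S A H) : ℝ :=
  (if x.1 0 = s then 1 else 0) *
    ∏ h : Fin H, π h (x.1 h.castSucc) (x.2 h) * P (x.1 h.castSucc) (x.2 h) (x.1 h.succ)

/-- The value `V_l^π(P)` from the initial state `s`: the expectation of the total cost `l`
accumulated during one episode. -/
def value (π : Policy S A H) (P : Model S A) (s : S) (l : S → A → ℝ) : ℝ :=
  ∑ x : Episode S A H, episodeProb π P s x * ∑ h : Fin H, l (x.1 h.castSucc) (x.2 h)

/-- `π` belongs to the set of safe policies. -/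
def IsSafe (M : CMDP S A) (π : Policy S A H) : Prop :=
  value π M.P M.s₁ M.c ≤ M.Cbar

/-- `π` is an optimal safe policy. -/
def IsOptimalSafe (M : CMDP S A) (π : Policy S A H) : Prop :=
  IsSafe M π ∧ ∀ π' : Policy S A H, IsSafe M π' →
    value π M.P M.s₁ M.r ≤ value π' M.P M.s₁ M.r

/-! ### Empirical model and confidence set, computed from `k` completed episodes -/

/-- The number of visits to `(s, a)` in the completed episodes `D`. -/
def visits {k : ℕ} (D : Fin k → Episode S A H) (s : S) (a : A) : ℕ :=
  (Finset.univ.filter fun p : Fin k × Fin H =>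
    (D p.1).1 p.2.castSucc = s ∧ (D p.1).2 p.2 = a).card

/-- The number of observed transitions `(s, a, s')` in the completed episodes `D`. -/
def transitions {k : ℕ} (D : Fin k → Episode S A H) (s : S) (a : A) (s' : S) : ℕ :=
  (Finset.univ.filter fun p : Fin k × Fin H =>
    (D p.1).1 p.2.castSucc = s ∧ (D p.1).2 p.2 = a ∧ (D p.1).1 p.2.succ = s').card

/-- The empirical estimate of `P(s' | s, a)`. -/
noncomputable def phat {k : ℕ} (D : Fin k → Episode S A H) (s : S) (a : A) (s' : S) : ℝ :=
  (transitions D s a s' : ℝ) / max (visits D s a : ℝ) 1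

/-- The logarithmic factor `L = log (2 S A H K / δ)`. -/
noncomputable def logFactor (S A : Type*) [Fintype S] [Fintype A] (H K : ℕ) (δ : ℝ) : ℝ :=
  Real.log (2 * Fintype.card S * Fintype.card A * H * K / δ)

/-- The confidence radius `β_k(s, a, s')`, with `L` the logarithmic factor. -/
noncomputable def beta (L : ℝ) {k : ℕ} (D : Fin k → Episode S A H) (s : S) (a : A) (s' : S) : ℝ :=
  √(4 * (phat D s a s' * (1 - phat D s a s')) * L / max (visits D s a : ℝ) 1) +
    14 * L / (3 * max (visits D s a : ℝ) 1)

/-- `β̄_k(s, a) = ∑_{s'} β_k(s, a, s')`. -/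
noncomputable def betaBar (L : ℝ) {k : ℕ} (D : Fin k → Episode S A H) (s : S) (a : A) : ℝ :=
  ∑ s', beta L D s a s'

/-- The confidence set `𝒫_k` of models. -/
def confidenceSet (L : ℝ) {k : ℕ} (D : Fin k → Episode S A H) : Set (Model S A) :=
  {P' | ∀ s a s', |P' s a s' - phat D s a s'| ≤ beta L D s a s'}

/-- The pessimistic constraint cost `c_k`. -/
noncomputable def pessimisticCost (M : CMDP S A) (L : ℝ) {k : ℕ} (D : Fin k → Episode S A H)
    (s : S) (a : A) : ℝ :=
  M.c s a + H * betaBar L D s a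

/-- The optimistic objective cost `r_k`; `Cb` is the constraint value of the baseline policy. -/
noncomputable def optimisticCost (M : CMDP S A) (Cb L : ℝ) {k : ℕ} (D : Fin k → Episode S A H)
    (s : S) (a : A) : ℝ :=
  M.r s a - (H : ℝ) ^ 2 / (M.Cbar - Cb) * betaBar L D s a

/-- The feasible pairs `(π', P')` of the optimistic-pessimistic (OP) problem. -/
def opFeasible (M : CMDP S A) (L : ℝ) {k : ℕ} (D : Fin k → Episode S A H) :
    Set (Policy S A H × Model S A) :=
  {q | q.2 ∈ confidenceSet L D ∧ value q.1 q.2 M.s₁ (pessimisticCost M L D) ≤ M.Cbar}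

/-- `q = (π_k, P_k)` is a solution of the OP problem. -/
def IsOPSolution (M : CMDP S A) (Cb L : ℝ) {k : ℕ} (D : Fin k → Episode S A H)
    (q : Policy S A H × Model S A) : Prop :=
  q ∈ opFeasible M L D ∧ ∀ q' ∈ opFeasible M L D,
    value q.1 q.2 M.s₁ (optimisticCost M Cb L D) ≤
      value q'.1 q'.2 M.s₁ (optimisticCost M Cb L D)

/-- A learning rule: from the observations of the first `k` episodes it computes the policy to be
played in the next one, i.e. in episode `k + 1`. -/
abbrev LearningRule (S A : Type*) [Fintype A] (H : ℕ) :=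
  (k : ℕ) → (Fin k → Episode S A H) → Policy S A H

/-- `alg` is an implementation of OPSRL over `K` episodes: in the first `Ko` episodes it plays the
baseline `πb`, afterwards the policy of some solution of the OP problem. Nothing is required of the
policy played after episode `Ko` when the OP problem has no feasible point, nor of the choice among
several solutions. -/
def IsOPSRL (M : CMDP S A) (K : ℕ) (δ : ℝ) (πb : Policy S A H) (Cb : ℝ) (Ko : ℕ)
    (alg : LearningRule S A H) : Prop :=
  ∀ k < K, ∀ D : Fin k → Episode S A H,
    (k + 1 ≤ Ko → alg k D = πb) ∧
    (Ko < k + 1 → (opFeasible M (logFactor S A H K δ) D).Nonempty →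
      ∃ P' : Model S A, IsOPSolution M Cb (logFactor S A H K δ) D (alg k D, P'))

/-- The first `k` episodes among the `K` episodes `ω`. -/
def past {K : ℕ} (ω : Fin K → Episode S A H) (k : Fin K) : Fin (k : ℕ) → Episode S A H :=
  fun i => ω (Fin.castLE k.isLt.le i)

/-- The policy played by `alg` in episode `k` when the observations are `ω`. -/
def played (alg : LearningRule S A H) {K : ℕ} (ω : Fin K → Episode S A H) (k : Fin K) :
    Policy S A H :=
  alg k (past ω k)

/-- The probability of observing the episodes `ω` when `alg` interacts with the CMDP. -/
def runProb (M : CMDP S A) (alg : LearningRule S A H) {K : ℕ} (ω : Fin K → Episode S A H) : ℝ :=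
  ∏ k : Fin K, episodeProb (played alg ω k) M.P M.s₁ (ω k)

theorem episodeProb_nonneg (π : Policy S A H) (P : Model S A) (s : S) (x : Episode S A H) :
    0 ≤ episodeProb π P s x := by
  unfold episodeProb
  refine mul_nonneg (by split_ifs <;> norm_num) (Finset.prod_nonneg fun h _ => mul_nonneg ?_ ?_)
  · exact (π h (x.1 h.castSucc)).2.1 _
  · exact (P (x.1 h.castSucc) (x.2 h)).2.1 _

theorem sum_episodeProb : ∀ {H : ℕ} (π : Policy S A H) (P : Model S A) (s : S),
    ∑ x : Episode S A H, episodeProb π P s x = 1 := by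
  intro H
  induction H with
  | zero =>
    intro π P s
    rw [Fintype.sum_prod_type, ← (Equiv.funUnique (Fin 1) S).symm.sum_comp]
    simp [episodeProb]
  | succ n ih =>
    intro π P s
    rw [← ih (fun h => π h.castSucc) P s, Fintype.sum_prod_type, Fintype.sum_prod_type,
      ← (Fin.snocEquiv (fun _ : Fin (n + 1 + 1) => S)).sum_comp, Fintype.sum_prod_type,
      Finset.sum_comm]
    refine Finset.sum_congr rfl fun f _ => ?_
    simp_rw [← (Fin.snocEquiv (fun _ : Fin (n + 1) => A)).sum_comp, Fintype.sum_prod_type]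
    rw [Finset.sum_comm]
    have hstep : ∀ (a : A) (s' : S) (g : Fin n → A),
        episodeProb π P s (Fin.snocEquiv (fun _ : Fin (n + 1 + 1) => S) (s', f),
          Fin.snocEquiv (fun _ : Fin (n + 1) => A) (a, g)) =
        episodeProb (fun h => π h.castSucc) P s (f, g) *
          (π (Fin.last n) (f (Fin.last n)) a * P (f (Fin.last n)) a s') := by
      intro a s' g
      have h0 : (Fin.snoc f s' : Fin (n + 1 + 1) → S) 0 = f 0 := by
        rw [← Fin.castSucc_zero, Fin.snoc_castSucc (α := fun _ => S)]
      simp only [episodeProb, Fin.snocEquiv, Equiv.coe_fn_mk, Fin.prod_univ_castSucc,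
        Fin.succ_last, ← Fin.castSucc_succ,
        Fin.snoc_castSucc (α := fun _ => S), Fin.snoc_castSucc (α := fun _ => A),
        Fin.snoc_last (α := fun _ => S), Fin.snoc_last (α := fun _ => A), h0]
      ring
    have hP : ∀ a, ∑ s', P (f (Fin.last n)) a s' = 1 := fun a => (P (f (Fin.last n)) a).2.2
    have hπ : ∑ a, π (Fin.last n) (f (Fin.last n)) a = 1 := (π (Fin.last n) (f (Fin.last n))).2.2
    calc _ = ∑ a, ∑ g, episodeProb (fun h => π h.castSucc) P s (f, g) *
          π (Fin.last n) (f (Fin.last n)) a := by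
          refine Finset.sum_congr rfl fun a _ => ?_
          rw [Finset.sum_comm]
          refine Finset.sum_congr rfl fun g _ => ?_
          simp_rw [hstep, ← Finset.mul_sum, hP, mul_one]
      _ = _ := by
          rw [Finset.sum_comm]
          simp_rw [← Finset.mul_sum, hπ, mul_one]

theorem runProb_nonneg (M : CMDP S A) (alg : LearningRule S A H) {K : ℕ}
    (ω : Fin K → Episode S A H) : 0 ≤ runProb M alg ω :=
  Finset.prod_nonneg fun _ _ => episodeProb_nonneg _ _ _ _

theorem sum_runProb (M : CMDP S A) (alg : LearningRule S A H) :
    ∀ K : ℕ, ∑ ω : Fin K → Episode S A H, runProb M alg ω = 1 := by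
  intro K
  induction K with
  | zero => simp [runProb]
  | succ n ih =>
    rw [← ih, ← (Fin.snocEquiv (fun _ : Fin (n + 1) => Episode S A H)).sum_comp,
      Fintype.sum_prod_type, Finset.sum_comm]
    refine Finset.sum_congr rfl fun ω _ => ?_
    have hstep : ∀ x : Episode S A H,
        runProb M alg (Fin.snocEquiv (fun _ : Fin (n + 1) => Episode S A H) (x, ω)) =
        runProb M alg ω * episodeProb (alg n ω) M.P M.s₁ x := by
      intro x
      have hc : ∀ k : Fin n, played alg
          (Fin.snoc ω x : Fin (n + 1) → Episode S A H) k.castSucc = played alg ω k := by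
        intro k
        unfold played
        congr 1
        funext i
        exact Fin.snoc_castSucc (α := fun _ => Episode S A H) x ω (Fin.castLE k.isLt.le i)
      have hl : played alg (Fin.snoc ω x : Fin (n + 1) → Episode S A H) (Fin.last n) =
          alg n ω := by
        unfold played
        congr 1
        funext i
        exact Fin.snoc_castSucc (α := fun _ => Episode S A H) x ω i
      simp only [runProb, Fin.snocEquiv, Equiv.coe_fn_mk, Fin.prod_univ_castSucc, hc, hl,
        Fin.snoc_castSucc (α := fun _ => Episode S A H),
        Fin.snoc_last (α := fun _ => Episode S A H)]
    simp_rw [hstep, ← Finset.mul_sum, sum_episodeProb, mul_one]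

/-- The law of the observations of `K` episodes when `alg` interacts with the CMDP. -/
noncomputable def runLaw (M : CMDP S A) (K : ℕ) (alg : LearningRule S A H) :
    PMF (Fin K → Episode S A H) :=
  PMF.ofFintype (fun ω => ENNReal.ofReal (runProb M alg ω)) (by
    rw [← ENNReal.ofReal_sum_of_nonneg fun ω _ => runProb_nonneg M alg ω, sum_runProb,
      ENNReal.ofReal_one])

/-- The regret of `alg` after the `K` episodes `ω`, with respect to the policy `πstar`. -/
noncomputable def regret (M : CMDP S A) (πstar : Policy S A H) (alg : LearningRule S A H) {K : ℕ}
    (ω : Fin K → Episode S A H) : ℝ :=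
  ∑ k : Fin K, (value (played alg ω k) M.P M.s₁ M.r - value πstar M.P M.s₁ M.r)

/-- The order of the baseline phase, `S² A H³ / (C̄ - C̄_b)²`. -/
noncomputable def baselineScale (S A : Type*) [Fintype S] [Fintype A] (H : ℕ) (Δ : ℝ) : ℝ :=
  (Fintype.card S : ℝ) ^ 2 * Fintype.card A * (H : ℝ) ^ 3 / Δ ^ 2

/-- The order of the regret, `S² A H⁴ / (C̄ - C̄_b)² + S² √(A H⁷ K) / (C̄ - C̄_b)`. -/
noncomputable def regretScale (S A : Type*) [Fintype S] [Fintype A] (H K : ℕ) (Δ : ℝ) : ℝ :=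
  (Fintype.card S : ℝ) ^ 2 * Fintype.card A * (H : ℝ) ^ 4 / Δ ^ 2 +
    (Fintype.card S : ℝ) ^ 2 / Δ * √(Fintype.card A * (H : ℝ) ^ 7 * K)

end

end OPSRL

/-!
All three claims hold on one event of probability at least `1 - δ`, `OPSRL.goodEvent`: before every
episode the true model lies in the confidence set, and the visit counts satisfy
`n(s, a) ≥ W(s, a) / 2 - H L`, where `W(s, a)` sums the conditional expectations of the visits in
the past episodes. Both parts follow from Ville's inequality for products of one factor per episode
(`probEvent_exists_le_pathProd`). For the confidence sets the factors form the likelihood ratio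
between the Bernoulli law with the observed frequency `m / n` and the true one, and there is one
supermartingale for every pair `(n, m)` of counts outside the confidence region. A Bernstein bound
for the relative entropy with the variance taken at the *empirical* mean
(`bernstein_le_klBernoulli`) shows that such a pair makes the likelihood ratio at least `exp (2 L)`.
The exponent `2 L`, not `L`, pays for the union over the third component `s'` and over both
counts, although `L` contains only one factor `S`.

On the good event the argument is deterministic. The baseline phase makes the bonus
`H V_{β̄}^{πb}(P)` of the baseline policy at most its slack `Δ = C̄ - C̄_b`
(`value_betaBar_baseline_le`), hence `(πb, P)` is feasible. Two models of the confidence set differ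
by at most `2 β̄` in `ℓ¹` distance and value functions of a cost in `[0, B]` have oscillation
at most `H B`, so that the bonus `H B β̄` compensates a change of the model
(`value_le_value_add_bonus`). For the constraint cost this is safety. For the objective cost it is
combined with optimism (`value_optimisticCost_le`): the mixture of `πb` and `π*` that just satisfies
the pessimistic constraint under the true model has optimistic cost at most the optimal value. The
regret of an episode is then at most `20 H³ L S / Δ` times the expected sum of the radii `β̄` under
the true model (`value_sub_value_le`), and these sums are controlled by the usual summation of
`q / √W` and `q / W` (`sum_value_betaBar_le`). After the baseline phase `K` is so large that the
lower-order terms are absorbed by the term with `√K`.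

Identities for values are proved by decomposing an episode at its first step; the value function of
the remaining episode is the value of the shifted policy.
-/

namespace OPSRL

set_option linter.unusedSectionVars false

variable {S A : Type*} [Fintype S] [Fintype A] [DecidableEq S] [DecidableEq A]

theorem sum_stdSimplex (p : stdSimplex ℝ S) : ∑ x, p x = 1 := p.2.2

theorem stdSimplex_apply_le_one (p : stdSimplex ℝ S) (x : S) : p x ≤ 1 := by
  rw [← sum_stdSimplex p]
  exact Finset.single_le_sum (f := fun x => p x) (fun x _ => p.2.1 x) (Finset.mem_univ x)

/-! ### Values as expectations over one episode -/

theorem sum_episode_succ {H : ℕ} (F : Episode S A (H + 1) → ℝ) :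
    ∑ x, F x = ∑ s₀, ∑ a, ∑ y : Episode S A H, F (Fin.cons s₀ y.1, Fin.cons a y.2) := by
  rw [Fintype.sum_prod_type, ← (Fin.consEquiv (fun _ : Fin (H + 1 + 1) => S)).sum_comp,
    Fintype.sum_prod_type]
  refine Finset.sum_congr rfl fun s₀ _ => ?_
  simp_rw [← (Fin.consEquiv (fun _ : Fin (H + 1) => A)).sum_comp, Fintype.sum_prod_type]
  rw [Finset.sum_comm]
  rfl

theorem episodeProb_cons {H : ℕ} (π : Policy S A (H + 1)) (P : Model S A) (s s₀ : S) (a : A)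
    (y : Episode S A H) :
    episodeProb π P s (Fin.cons s₀ y.1, Fin.cons a y.2) =
      (if s₀ = s then 1 else 0) * (π 0 s₀ a *
        ∑ s', P s₀ a s' * episodeProb (fun h => π h.succ) P s' y) := by
  have h1 : ∑ s', P s₀ a s' * episodeProb (fun h => π h.succ) P s' y =
      P s₀ a (y.1 0) * ∏ h : Fin H, π h.succ (y.1 h.castSucc) (y.2 h) *
        P (y.1 h.castSucc) (y.2 h) (y.1 h.succ) := by
    simp [episodeProb]
  rw [h1]
  simp [episodeProb, Fin.prod_univ_succ, mul_assoc]

/-- First-step decomposition of an expectation over one episode. -/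
theorem sum_episodeProb_mul_succ {H : ℕ} (π : Policy S A (H + 1)) (P : Model S A) (s : S)
    (F : Episode S A (H + 1) → ℝ) :
    ∑ x, episodeProb π P s x * F x = ∑ a, π 0 s a * ∑ s', P s a s' *
      ∑ y, episodeProb (fun h => π h.succ) P s' y * F (Fin.cons s y.1, Fin.cons a y.2) := by
  rw [sum_episode_succ, Finset.sum_eq_single s]
  · refine Finset.sum_congr rfl fun a _ => ?_
    simp_rw [episodeProb_cons, if_true, one_mul, mul_assoc, Finset.sum_mul, Finset.mul_sum,
      mul_assoc]
    rw [Finset.sum_comm]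
  · intro s₀ _ h
    simp [episodeProb_cons, h]
  · simp

theorem value_succ {H : ℕ} (π : Policy S A (H + 1)) (P : Model S A) (s : S) (l : S → A → ℝ) :
    value π P s l = ∑ a, π 0 s a * (l s a +
      ∑ s', P s a s' * value (fun h => π h.succ) P s' l) := by
  unfold value
  rw [sum_episodeProb_mul_succ]
  refine Finset.sum_congr rfl fun a _ => ?_
  congr 1
  simp only [Fin.sum_univ_succ, Fin.castSucc_zero, Fin.cons_zero, ← Fin.succ_castSucc,
    Fin.cons_succ, mul_add, Finset.sum_add_distrib, ← Finset.sum_mul, sum_episodeProb, one_mul]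
  rw [sum_stdSimplex, one_mul]

theorem value_zero (π : Policy S A 0) (P : Model S A) (s : S) (l : S → A → ℝ) :
    value π P s l = 0 := by
  simp [value]

section Value

variable {H : ℕ} (π : Policy S A H) (P : Model S A) (s : S)

theorem value_add (l l' : S → A → ℝ) :
    value π P s (fun x a => l x a + l' x a) = value π P s l + value π P s l' := by
  simp [value, Finset.sum_add_distrib, mul_add]

theorem value_const_mul (c : ℝ) (l : S → A → ℝ) :
    value π P s (fun x a => c * l x a) = c * value π P s l := by
  simp only [value, ← Finset.mul_sum]
  rw [Finset.mul_sum]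
  exact Finset.sum_congr rfl fun _ _ => by ring

theorem value_const (c : ℝ) : value π P s (fun _ _ => c) = H * c := by
  simp only [value, Finset.sum_const, Finset.card_univ, Fintype.card_fin, nsmul_eq_mul]
  rw [← Finset.sum_mul, sum_episodeProb, one_mul]

theorem value_mono {l l' : S → A → ℝ} (h : ∀ x a, l x a ≤ l' x a) :
    value π P s l ≤ value π P s l' :=
  Finset.sum_le_sum fun x _ => mul_le_mul_of_nonneg_left
    (Finset.sum_le_sum fun _ _ => h _ _) (episodeProb_nonneg π P s x)

theorem value_nonneg {l : S → A → ℝ} (h : ∀ x a, 0 ≤ l x a) : 0 ≤ value π P s l := by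
  simpa [value_const] using value_mono π P s (l := fun _ _ => 0) h

theorem value_le {l : S → A → ℝ} {B : ℝ} (h : ∀ x a, l x a ≤ B) : value π P s l ≤ H * B := by
  simpa [value_const] using value_mono π P s (l' := fun _ _ => B) h

/-- The expected number of visits to `(x, a)` during one episode. -/
def occupancy (x : S) (a : A) : ℝ :=
  value π P s (fun x' a' => if x' = x ∧ a' = a then 1 else 0)

theorem value_eq_sum_occupancy (l : S → A → ℝ) :
    value π P s l = ∑ x, ∑ a, occupancy π P s x a * l x a := by
  have hl : ∀ x' a', l x' a' = ∑ p : S × A, if x' = p.1 ∧ a' = p.2 then l p.1 p.2 else 0 := by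
    intro x' a'
    rw [Finset.sum_eq_single (x', a')]
    · simp
    · rintro ⟨x, a⟩ _ h
      rw [if_neg]
      rintro ⟨rfl, rfl⟩
      exact h rfl
    · simp
  rw [← Fintype.sum_prod_type' (f := fun x a => occupancy π P s x a * l x a)]
  simp only [occupancy, value, Finset.sum_mul]
  rw [Finset.sum_comm]
  refine Finset.sum_congr rfl fun y _ => ?_
  simp only [mul_assoc, ← Finset.mul_sum, Finset.sum_mul]
  congr 1
  rw [Finset.sum_comm]
  refine Finset.sum_congr rfl fun h _ => ?_
  rw [hl]
  refine Finset.sum_congr rfl fun p _ => ?_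
  split_ifs <;> simp

theorem occupancy_nonneg (x : S) (a : A) : 0 ≤ occupancy π P s x a :=
  value_nonneg π P s fun _ _ => by split_ifs <;> norm_num

theorem occupancy_le (x : S) (a : A) : occupancy π P s x a ≤ H := by
  simpa [occupancy] using value_le π P s (B := 1)
    (l := fun x' a' => if x' = x ∧ a' = a then 1 else 0) fun _ _ => by split_ifs <;> norm_num

theorem sum_occupancy : ∑ x, ∑ a, occupancy π P s x a = H := by
  simpa [value_const] using (value_eq_sum_occupancy π P s fun _ _ => 1).symm

end Value

/-- Two probability vectors that are both `b`-close to `f`, applied to a function with values in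
`[0, D]`. The constant `D / 2` is subtracted from the function, so that the factor `2` from the
triangle inequality is compensated. -/
theorem sum_mul_le_sum_mul_add (p p' : stdSimplex ℝ S) (f b V : S → ℝ) {D : ℝ}
    (hp : ∀ x, |p x - f x| ≤ b x) (hp' : ∀ x, |p' x - f x| ≤ b x)
    (hV₀ : ∀ x, 0 ≤ V x) (hVD : ∀ x, V x ≤ D) :
    ∑ x, p x * V x ≤ ∑ x, p' x * V x + D * ∑ x, b x := by
  have h3 : ∑ x, p x * V x - ∑ x, p' x * V x = ∑ x, (p x - p' x) * (V x - D / 2) := by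
    simp only [sub_mul, mul_sub, Finset.sum_sub_distrib, ← Finset.sum_mul, sum_stdSimplex]
    ring
  have h4 : ∑ x, (p x - p' x) * (V x - D / 2) ≤ ∑ x, D * b x := by
    refine Finset.sum_le_sum fun x _ => ?_
    have ha := abs_le.1 (hp x)
    have hb := abs_le.1 (hp' x)
    have h5 : |p x - p' x| ≤ 2 * b x := abs_le.2 ⟨by linarith, by linarith⟩
    have h6 : |V x - D / 2| ≤ D / 2 := abs_le.2 ⟨by linarith [hV₀ x], by linarith [hVD x]⟩
    calc _ ≤ |(p x - p' x) * (V x - D / 2)| := le_abs_self _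
      _ = |p x - p' x| * |V x - D / 2| := abs_mul _ _
      _ ≤ 2 * b x * (D / 2) := by
          gcongr
          exact (abs_nonneg _).trans h5
      _ = _ := by ring
  rw [← Finset.mul_sum] at h4
  linarith

/-- Simulation lemma: for a cost with values in `[0, B]`, replacing a model by another one of the
same confidence region is compensated by adding the bonus `D β̄`, `D ≥ H B`, to the cost. -/
theorem value_le_value_add_bonus {P P' : Model S A} {f b : S → A → S → ℝ}
    (hP : ∀ s a s', |P s a s' - f s a s'| ≤ b s a s')
    (hP' : ∀ s a s', |P' s a s' - f s a s'| ≤ b s a s')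
    {l : S → A → ℝ} {B D : ℝ} (hB : 0 ≤ B) (hl₀ : ∀ s a, 0 ≤ l s a) (hlB : ∀ s a, l s a ≤ B) :
    ∀ {H : ℕ}, H * B ≤ D → ∀ (π : Policy S A H) (s : S),
      value π P s l ≤ value π P' s (fun x a => l x a + D * ∑ s', b x a s') := by
  intro H
  induction H with
  | zero => intro _ π s; simp [value_zero]
  | succ n ih =>
    intro hD π s
    push_cast at hD
    have hn : (n : ℝ) * B ≤ D := by linarith
    rw [value_succ, value_succ]
    refine Finset.sum_le_sum fun a _ => mul_le_mul_of_nonneg_left ?_ ((π 0 s).2.1 a)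
    have h1 := sum_mul_le_sum_mul_add (P s a) (P' s a) (f s a) (b s a)
      (fun s' => value (fun h => π h.succ) P s' l) (hP s a) (hP' s a)
      (fun s' => value_nonneg _ _ _ hl₀) (fun s' => (value_le _ _ _ hlB).trans hn)
    have h2 : ∑ s', P' s a s' * value (fun h => π h.succ) P s' l ≤
        ∑ s', P' s a s' * value (fun h => π h.succ) P' s'
          (fun x a => l x a + D * ∑ s', b x a s') :=
      Finset.sum_le_sum fun s' _ => mul_le_mul_of_nonneg_left (ih hn _ _) ((P' s a).2.1 s')
    linarith

/-- Two policies started from the weighted state distributions `w₁` and `w₂` are jointly simulated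
by one Markov policy, which picks its actions by Bayes' rule. -/
theorem exists_policy_value_add (P : Model S A) : ∀ {H : ℕ} (π₁ π₂ : Policy S A H)
    (w₁ w₂ : S → ℝ), (∀ s, 0 ≤ w₁ s) → (∀ s, 0 ≤ w₂ s) →
    ∃ π : Policy S A H, ∀ l : S → A → ℝ, ∑ s, (w₁ s + w₂ s) * value π P s l =
      ∑ s, w₁ s * value π₁ P s l + ∑ s, w₂ s * value π₂ P s l := by
  intro H
  induction H with
  | zero => intro π₁ π₂ w₁ w₂ _ _; exact ⟨π₁, fun l => by simp [value_zero]⟩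
  | succ n ih =>
    intro π₁ π₂ w₁ w₂ h₁ h₂
    have hμ : ∀ s, ∃ μ : stdSimplex ℝ A, ∀ a,
        (w₁ s + w₂ s) * μ a = w₁ s * π₁ 0 s a + w₂ s * π₂ 0 s a := by
      intro s
      rcases (add_nonneg (h₁ s) (h₂ s)).eq_or_lt with h | h
      · have e₁ : w₁ s = 0 := by linarith [h₁ s, h₂ s]
        have e₂ : w₂ s = 0 := by linarith [h₁ s, h₂ s]
        exact ⟨π₁ 0 s, fun a => by simp [e₁, e₂]⟩
      · refine ⟨⟨fun a => (w₁ s * π₁ 0 s a + w₂ s * π₂ 0 s a) / (w₁ s + w₂ s),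
          fun a => ?_, ?_⟩, fun a => ?_⟩
        · exact div_nonneg (add_nonneg (mul_nonneg (h₁ s) ((π₁ 0 s).2.1 a))
            (mul_nonneg (h₂ s) ((π₂ 0 s).2.1 a))) h.le
        · rw [← Finset.sum_div, Finset.sum_add_distrib, ← Finset.mul_sum, ← Finset.mul_sum,
            sum_stdSimplex, sum_stdSimplex, mul_one, mul_one, div_self h.ne']
        · exact mul_div_cancel₀ _ h.ne'
    choose μ hμ using hμ
    have nonneg : ∀ (w : S → ℝ) (π : Policy S A (n + 1)), (∀ s, 0 ≤ w s) →
        ∀ s', 0 ≤ ∑ s, ∑ a, w s * π 0 s a * P s a s' := fun w π hw s' =>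
      Finset.sum_nonneg fun s _ => Finset.sum_nonneg fun a _ =>
        mul_nonneg (mul_nonneg (hw s) ((π 0 s).2.1 a)) ((P s a).2.1 s')
    obtain ⟨τ, hτ⟩ := ih (fun h => π₁ h.succ) (fun h => π₂ h.succ)
      (fun s' => ∑ s, ∑ a, w₁ s * π₁ 0 s a * P s a s')
      (fun s' => ∑ s, ∑ a, w₂ s * π₂ 0 s a * P s a s') (nonneg w₁ π₁ h₁) (nonneg w₂ π₂ h₂)
    refine ⟨Fin.cons μ τ, fun l => ?_⟩
    -- the value started from a weighted state distribution, after one step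
    have step : ∀ (w : S → ℝ) (ν : S → A → ℝ) (V : S → ℝ),
        ∑ s, w s * ∑ a, ν s a * (l s a + ∑ s', P s a s' * V s') =
          ∑ s, ∑ a, w s * ν s a * l s a +
            ∑ s', (∑ s, ∑ a, w s * ν s a * P s a s') * V s' := by
      intro w ν V
      simp only [Finset.sum_mul]
      rw [Finset.sum_comm (s := (Finset.univ : Finset S)) (t := (Finset.univ : Finset S))
        (f := fun s' s => ∑ a, w s * ν s a * P s a s' * V s'), ← Finset.sum_add_distrib]
      refine Finset.sum_congr rfl fun s _ => ?_
      rw [Finset.sum_comm, ← Finset.sum_add_distrib, Finset.mul_sum]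
      refine Finset.sum_congr rfl fun a _ => ?_
      rw [mul_add, mul_add, Finset.mul_sum, Finset.mul_sum, mul_assoc]
      exact congrArg _ (Finset.sum_congr rfl fun _ _ => by ring)
    simp only [value_succ, Fin.cons_zero, Fin.cons_succ]
    rw [step _ (fun s a => μ s a), step _ (fun s a => π₁ 0 s a), step _ (fun s a => π₂ 0 s a)]
    simp only [hμ, add_mul, Finset.sum_add_distrib] at hτ ⊢
    linarith [hτ l]

/-- Every convex combination of the values of two policies is attained by a Markov policy,
simultaneously for all costs. -/
theorem exists_policy_value_eq {H : ℕ} (P : Model S A) (s : S) (π₁ π₂ : Policy S A H) {γ : ℝ}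
    (h₀ : 0 ≤ γ) (h₁ : γ ≤ 1) :
    ∃ π : Policy S A H, ∀ l : S → A → ℝ,
      value π P s l = (1 - γ) * value π₁ P s l + γ * value π₂ P s l := by
  obtain ⟨π, hπ⟩ := exists_policy_value_add P π₁ π₂
    (fun x => if x = s then 1 - γ else 0) (fun x => if x = s then γ else 0)
    (fun x => by split_ifs <;> linarith) (fun x => by split_ifs <;> linarith)
  refine ⟨π, fun l => ?_⟩
  have := hπ l
  simp only [add_mul, Finset.sum_add_distrib, ite_mul, zero_mul, Finset.sum_ite_eq',
    Finset.mem_univ, if_true] at this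
  linarith

/-- The product of step factors whose conditional means are at most `1` has mean at most `1`. -/
theorem sum_episodeProb_mul_prod_le_one (P : Model S A) (f : S → A → S → ℝ)
    (hf : ∀ s a, ∑ s', P s a s' * f s a s' ≤ 1) (hf₀ : ∀ s a s', 0 ≤ f s a s') :
    ∀ {H : ℕ} (π : Policy S A H) (s : S), ∑ x : Episode S A H, episodeProb π P s x *
      ∏ h : Fin H, f (x.1 h.castSucc) (x.2 h) (x.1 h.succ) ≤ 1 := by
  intro H
  induction H with
  | zero => intro π s; simpa using (sum_episodeProb π P s).le
  | succ n ih =>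
    intro π s
    rw [sum_episodeProb_mul_succ]
    have h1 : ∀ a s', ∑ y : Episode S A n, episodeProb (fun h => π h.succ) P s' y *
        ∏ h : Fin (n + 1), f ((Fin.cons s y.1 : Fin (n + 2) → S) h.castSucc)
          ((Fin.cons a y.2 : Fin (n + 1) → A) h) ((Fin.cons s y.1 : Fin (n + 2) → S) h.succ) ≤
        f s a s' := by
      intro a s'
      calc _ = f s a s' * ∑ y : Episode S A n, episodeProb (fun h => π h.succ) P s' y *
            ∏ h : Fin n, f (y.1 h.castSucc) (y.2 h) (y.1 h.succ) := by
            rw [Finset.mul_sum]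
            refine Finset.sum_congr rfl fun y _ => ?_
            simp only [Fin.prod_univ_succ, Fin.castSucc_zero, Fin.cons_zero, ← Fin.succ_castSucc,
              Fin.cons_succ]
            by_cases h : y.1 0 = s'
            · rw [h]; ring
            · simp [episodeProb, h]
        _ ≤ f s a s' * 1 := mul_le_mul_of_nonneg_left (ih _ _) (hf₀ s a s')
        _ = _ := mul_one _
    calc _ ≤ ∑ a, π 0 s a * 1 := by
          refine Finset.sum_le_sum fun a _ => mul_le_mul_of_nonneg_left ?_ ((π 0 s).2.1 a)
          refine le_trans ?_ (hf s a)
          exact Finset.sum_le_sum fun s' _ => mul_le_mul_of_nonneg_left (h1 a s') ((P s a).2.1 s')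
      _ = 1 := by simp

/-! ### Probabilities of events of a run -/

section Run

variable {H : ℕ} (M : CMDP S A) (alg : LearningRule S A H)

/-- The probability of the event `E` of a run of `K` episodes, as a real number. -/
noncomputable def probEvent {K : ℕ} (E : Set (Fin K → Episode S A H)) : ℝ :=
  ∑ ω, E.indicator (runProb M alg) ω

theorem probEvent_mono {K : ℕ} {E E' : Set (Fin K → Episode S A H)} (h : E ⊆ E') :
    probEvent M alg E ≤ probEvent M alg E' :=
  Finset.sum_le_sum fun ω _ =>
    Set.indicator_le_indicator_of_subset h (fun ω => runProb_nonneg M alg ω) ω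

theorem probEvent_union_le {K : ℕ} (E E' : Set (Fin K → Episode S A H)) :
    probEvent M alg (E ∪ E') ≤ probEvent M alg E + probEvent M alg E' := by
  unfold probEvent
  rw [← Finset.sum_add_distrib]
  refine Finset.sum_le_sum fun ω _ => ?_
  have h := runProb_nonneg M alg ω
  by_cases h1 : ω ∈ E <;> by_cases h2 : ω ∈ E' <;> simp [h1, h2, h]

theorem probEvent_iUnion_le {K : ℕ} {ι : Type*} (t : Finset ι)
    (E : ι → Set (Fin K → Episode S A H)) {ε : ℝ} (h : ∀ i ∈ t, probEvent M alg (E i) ≤ ε) :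
    probEvent M alg (⋃ i ∈ t, E i) ≤ t.card * ε := by
  classical
  induction t using Finset.induction_on with
  | empty => simp [probEvent]
  | insert i t hi ih =>
    rw [Finset.set_biUnion_insert, Finset.card_insert_of_notMem hi]
    push_cast
    linarith [probEvent_union_le M alg (E i) (⋃ j ∈ t, E j), h i (Finset.mem_insert_self i t),
      ih fun j hj => h j (Finset.mem_insert_of_mem hj)]

theorem ofReal_le_runLaw {K : ℕ} {E G : Set (Fin K → Episode S A H)} {ε : ℝ}
    (hE : probEvent M alg Eᶜ ≤ ε) (hG : E ⊆ G) :
    ENNReal.ofReal (1 - ε) ≤ (runLaw M K alg).toOuterMeasure G := by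
  have h1 : 1 - ε ≤ probEvent M alg E := by
    have : probEvent M alg E + probEvent M alg Eᶜ = 1 := by
      rw [probEvent, probEvent, ← Finset.sum_add_distrib, ← sum_runProb M alg K]
      exact Finset.sum_congr rfl fun ω _ => Set.indicator_self_add_compl_apply _ _ _
    linarith
  calc _ ≤ ENNReal.ofReal (probEvent M alg E) := ENNReal.ofReal_le_ofReal h1
    _ = (runLaw M K alg).toOuterMeasure E := by
        rw [PMF.toOuterMeasure_apply_fintype, probEvent, ENNReal.ofReal_sum_of_nonneg]
        · refine Finset.sum_congr rfl fun ω _ => ?_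
          by_cases h : ω ∈ E <;> simp [h, runLaw]
        · exact fun ω _ => Set.indicator_nonneg (fun ω _ => runProb_nonneg M alg ω) ω
    _ ≤ _ := MeasureTheory.measure_mono hG

theorem past_snoc_castSucc {n : ℕ} (ω : Fin n → Episode S A H) (x : Episode S A H)
    (k : Fin n) :
    past (Fin.snoc ω x : Fin (n + 1) → Episode S A H) k.castSucc = past ω k := by
  funext i
  exact Fin.snoc_castSucc (α := fun _ => Episode S A H) x ω (Fin.castLE k.isLt.le i)

theorem past_snoc_last {n : ℕ} (ω : Fin n → Episode S A H) (x : Episode S A H) :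
    past (Fin.snoc ω x : Fin (n + 1) → Episode S A H) (Fin.last n) = ω := by
  funext i
  exact Fin.snoc_castSucc (α := fun _ => Episode S A H) x ω i

/-- The product over the episodes of `D` of factors that depend on the episode and its past. -/
def pathProd (F : (k : ℕ) → (Fin k → Episode S A H) → Episode S A H → ℝ) {k : ℕ}
    (D : Fin k → Episode S A H) : ℝ :=
  ∏ i : Fin k, F i (past D i) (D i)

theorem pathProd_nonneg {F : (k : ℕ) → (Fin k → Episode S A H) → Episode S A H → ℝ}
    (hF : ∀ k D x, 0 ≤ F k D x) {k : ℕ} (D : Fin k → Episode S A H) : 0 ≤ pathProd F D :=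
  Finset.prod_nonneg fun _ _ => hF _ _ _

theorem pathProd_snoc (F : (k : ℕ) → (Fin k → Episode S A H) → Episode S A H → ℝ) {n : ℕ}
    (ω : Fin n → Episode S A H) (x : Episode S A H) :
    pathProd F (Fin.snoc ω x : Fin (n + 1) → Episode S A H) = pathProd F ω * F n ω x := by
  unfold pathProd
  rw [Fin.prod_univ_castSucc]
  congr 1
  · refine Finset.prod_congr rfl fun i _ => ?_
    rw [past_snoc_castSucc, Fin.snoc_castSucc (α := fun _ => Episode S A H)]
    rfl
  · rw [past_snoc_last, Fin.snoc_last (α := fun _ => Episode S A H)]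
    rfl

theorem runProb_eq_pathProd {K : ℕ} (ω : Fin K → Episode S A H) :
    runProb M alg ω = pathProd (fun k D x => episodeProb (alg k D) M.P M.s₁ x) ω := rfl

/-- Ville's maximal inequality: a nonnegative supermartingale that starts at `1` and is a product
of one factor per episode exceeds the level `c` before some episode with probability at most
`1 / c`. -/
theorem probEvent_exists_le_pathProd
    (F : (k : ℕ) → (Fin k → Episode S A H) → Episode S A H → ℝ) (hF₀ : ∀ k D x, 0 ≤ F k D x)
    (hF : ∀ k (D : Fin k → Episode S A H),
      ∑ x, episodeProb (alg k D) M.P M.s₁ x * F k D x ≤ 1) {c : ℝ} (hc : 0 < c) (K : ℕ) :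
    probEvent M alg {ω : Fin K → Episode S A H | ∃ k : Fin K, c ≤ pathProd F (past ω k)} ≤
      1 / c := by
  classical
  have key : ∀ K : ℕ, ∑ ω : Fin K → Episode S A H, runProb M alg ω *
      (if ∃ k : Fin K, c ≤ pathProd F (past ω k) then c else pathProd F ω) ≤ 1 := by
    intro K
    induction K with
    | zero => simp [runProb, pathProd]
    | succ n ih =>
      rw [← (Fin.snocEquiv (fun _ : Fin (n + 1) => Episode S A H)).sum_comp,
        Fintype.sum_prod_type, Finset.sum_comm]
      refine le_trans (Finset.sum_le_sum fun ω _ => ?_) ih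
      have hex : ∀ x, (∃ k : Fin (n + 1), c ≤ pathProd F
          (past (Fin.snoc ω x : Fin (n + 1) → Episode S A H) k)) ↔
          (∃ k : Fin n, c ≤ pathProd F (past ω k)) ∨ c ≤ pathProd F ω := by
        intro x
        rw [Fin.exists_fin_succ', past_snoc_last]
        refine or_congr (exists_congr fun k => ?_) Iff.rfl
        rw [past_snoc_castSucc]
      have hsum := hF n ω
      have hp := pathProd_nonneg hF₀ ω
      have hr := runProb_nonneg M alg ω
      simp only [Fin.snocEquiv, Equiv.coe_fn_mk, hex, pathProd_snoc, runProb_eq_pathProd] at hr ⊢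
      simp only [mul_assoc, ← Finset.mul_sum]
      refine mul_le_mul_of_nonneg_left ?_ hr
      split_ifs with h1 h2 h2
      · rw [← Finset.sum_mul, sum_episodeProb, one_mul]
      · rw [← Finset.sum_mul, sum_episodeProb, one_mul]
        exact h1.resolve_left h2
      · exact absurd (Or.inl h2) h1
      · calc _ = pathProd F ω * ∑ x, episodeProb (alg n ω) M.P M.s₁ x * F n ω x := by
              rw [Finset.mul_sum]
              exact Finset.sum_congr rfl fun _ _ => by ring
          _ ≤ _ := mul_le_of_le_one_right hp hsum
  rw [le_div_iff₀ hc, probEvent, Finset.sum_mul]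
  refine le_trans (Finset.sum_le_sum fun ω _ => ?_) (key K)
  have hr := runProb_nonneg M alg ω
  by_cases h : ∃ k : Fin K, c ≤ pathProd F (past ω k)
  · rw [Set.indicator_of_mem (by exact h), if_pos h]
  · rw [Set.indicator_of_notMem (by exact h), if_neg h, zero_mul]
    exact mul_nonneg hr (pathProd_nonneg hF₀ ω)

end Run

/-! ### A Bernstein bound for Bernoulli relative entropies -/

/-- The relative entropy of two Bernoulli laws is at least
`d² / (2 (x (1 - x) + 2 d / 3))`, `d = p - x`, with the variance taken at the empirical
mean `x`. Both sides vanish at `p = x`, and their derivatives in `p` are compared. -/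
theorem bernstein_le_klBernoulli_of_le {x p : ℝ} (hx : 0 ≤ x) (hxp : x ≤ p) (hp : p < 1) :
    (p - x) ^ 2 / (2 * (x * (1 - x) + 2 * (p - x) / 3)) ≤
      x * Real.log (x / p) + (1 - x) * Real.log ((1 - x) / (1 - p)) := by
  rcases hx.eq_or_lt with rfl | hx
  · rcases hxp.eq_or_lt with rfl | hp0
    · simp
    · have h1 : Real.log (1 - p) ≤ -p := by
        linarith [Real.log_le_sub_one_of_pos (show 0 < 1 - p by linarith)]
      have h2 : (p - 0) ^ 2 / (2 * (0 * (1 - 0) + 2 * (p - 0) / 3)) = 3 * p / 4 := by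
        field_simp
        ring
      rw [h2]
      simp only [zero_mul, sub_zero, one_mul, zero_add, one_div, Real.log_inv]
      linarith
  · have hv : 0 < x * (1 - x) := mul_pos hx (by linarith)
    let g : ℝ → ℝ := fun t => x * (Real.log x - Real.log t) +
      (1 - x) * (Real.log (1 - x) - Real.log (1 - t)) -
        (t - x) ^ 2 / (2 * (x * (1 - x) + 2 * (t - x) / 3))
    have hd : ∀ t, x ≤ t → t < 1 → HasDerivAt g (x * (0 - 1 / t) +
        (1 - x) * (0 - (-1) / (1 - t)) -
        ((2 * (t - x)) * (2 * (x * (1 - x) + 2 * (t - x) / 3)) - (t - x) ^ 2 * (4 / 3)) /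
          (2 * (x * (1 - x) + 2 * (t - x) / 3)) ^ 2) t := by
      intro t hxt ht
      have hid : HasDerivAt (fun t : ℝ => t) 1 t := hasDerivAt_id t
      have hsub : HasDerivAt (fun t : ℝ => t - x) 1 t := hid.sub_const x
      have h1 : HasDerivAt (fun t => Real.log t) (1 / t) t := hid.log (by linarith)
      have h2 : HasDerivAt (fun t : ℝ => Real.log (1 - t)) ((-1) / (1 - t)) t :=
        (hid.const_sub 1).log (by linarith)
      have h3 : HasDerivAt (fun t => (t - x) ^ 2) (2 * (t - x)) t := by
        exact (hsub.pow 2).congr_deriv (by simp)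
      have h4 : HasDerivAt (fun t => 2 * (x * (1 - x) + 2 * (t - x) / 3)) (4 / 3) t := by
        exact (((((hsub.const_mul 2).div_const 3).const_add (x * (1 - x))).const_mul 2)).congr_deriv
          (by norm_num)
      have h5 := h3.div h4 (by
        have : 0 ≤ t - x := by linarith
        positivity)
      exact ((((hasDerivAt_const t (Real.log x)).sub h1).const_mul x).add
        (((hasDerivAt_const t (Real.log (1 - x))).sub h2).const_mul (1 - x))).sub h5
    have hmono : MonotoneOn g (Set.Icc x p) := by
      refine monotoneOn_of_deriv_nonneg (convex_Icc x p)
        (fun t ht => (hd t ht.1 (by linarith [ht.2])).continuousAt.continuousWithinAt)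
        (fun t ht => ?_) fun t ht => ?_
      · rw [interior_Icc] at ht
        exact (hd t ht.1.le (by linarith [ht.2])).differentiableAt.differentiableWithinAt
      · rw [interior_Icc] at ht
        have h0 : 0 < t := by linarith [ht.1]
        have h1 : 0 < 1 - t := by linarith [ht.2]
        rw [(hd t ht.1.le (by linarith [ht.2])).deriv]
        obtain ⟨d, rfl⟩ : ∃ d, t = x + d := ⟨t - x, by ring⟩
        have hd0 : 0 < d := by linarith [ht.1]
        set v := x * (1 - x) with hvdef
        have e1 : x * (0 - 1 / (x + d)) + (1 - x) * (0 - (-1) / (1 - (x + d))) =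
            d / ((x + d) * (1 - (x + d))) := by
          field_simp
          ring
        have e2 : ((2 * (x + d - x)) * (2 * (v + 2 * (x + d - x) / 3)) -
            (x + d - x) ^ 2 * (4 / 3)) / (2 * (v + 2 * (x + d - x) / 3)) ^ 2 =
            d * (v + d / 3) / (v + 2 * d / 3) ^ 2 := by
          have : v + 2 * d / 3 ≠ 0 := by positivity
          rw [add_sub_cancel_left]
          field_simp
          ring
        rw [e1, e2, sub_nonneg, div_le_div_iff₀ (by positivity) (by positivity)]
        have h2 : (x + d) * (1 - (x + d)) ≤ v + d := by
          rw [hvdef]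
          nlinarith
        have h3 : (v + d / 3) * (v + d) ≤ (v + 2 * d / 3) ^ 2 := by nlinarith
        calc d * (v + d / 3) * ((x + d) * (1 - (x + d)))
            ≤ d * (v + d / 3) * (v + d) := by gcongr
          _ = d * ((v + d / 3) * (v + d)) := by ring
          _ ≤ _ := by gcongr
    have h := hmono (Set.left_mem_Icc.2 hxp) (Set.right_mem_Icc.2 hxp) hxp
    rw [Real.log_div hx.ne' (by linarith), Real.log_div (by linarith) (by linarith)]
    simp only [g, sub_self] at h
    norm_num at h
    linarith

theorem bernstein_le_klBernoulli {x p : ℝ} (hx₀ : 0 ≤ x) (hx₁ : x ≤ 1) (hp₀ : 0 < p)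
    (hp₁ : p < 1) :
    |p - x| ^ 2 / (2 * (x * (1 - x) + 2 * |p - x| / 3)) ≤
      x * Real.log (x / p) + (1 - x) * Real.log ((1 - x) / (1 - p)) := by
  rcases le_total x p with h | h
  · rw [abs_of_nonneg (sub_nonneg.2 h)]
    exact bernstein_le_klBernoulli_of_le hx₀ h hp₁
  · have := bernstein_le_klBernoulli_of_le (x := 1 - x) (p := 1 - p) (by linarith) (by linarith)
      (by linarith)
    rw [abs_of_nonpos (sub_nonpos.2 h)]
    simp only [sub_sub_cancel] at this
    convert this using 1
    · congr 1 <;> ring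
    · ring

/-- If `x` deviates from `p` by more than the empirical Bernstein radius for the sample size `n`
and the level `L`, then `n` times the relative entropy is at least `2 L`. -/
theorem two_mul_le_klBernoulli {x p L n : ℝ} (hx₀ : 0 ≤ x) (hx₁ : x ≤ 1) (hp₀ : 0 < p)
    (hp₁ : p < 1) (hL : 0 < L) (hn : 0 < n)
    (h : √(4 * (x * (1 - x)) * L / n) + 14 * L / (3 * n) < |p - x|) :
    2 * L ≤ n * (x * Real.log (x / p) + (1 - x) * Real.log ((1 - x) / (1 - p))) := by
  refine le_trans ?_ (mul_le_mul_of_nonneg_left (bernstein_le_klBernoulli hx₀ hx₁ hp₀ hp₁) hn.le)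
  set d := |p - x|
  set v := x * (1 - x) with hv
  have hv0 : 0 ≤ v := mul_nonneg hx₀ (by linarith)
  have e1 : 4 * v * L / n = 4 * v * (L / n) := by ring
  have e2 : 14 * L / (3 * n) = 14 / 3 * (L / n) := by field_simp
  rw [e1, e2] at h
  have hL' : L = L / n * n := by field_simp
  set ℓ := L / n
  have hℓ : 0 < ℓ := by positivity
  have hs := Real.sq_sqrt (show 0 ≤ 4 * v * ℓ by positivity)
  have hs0 := Real.sqrt_nonneg (4 * v * ℓ)
  set r := √(4 * v * ℓ)
  have hd : 0 < d := by linarith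
  have hmain : 4 * ℓ * (v + 2 * d / 3) ≤ d ^ 2 := by nlinarith
  rw [hL', mul_div_assoc', le_div_iff₀ (by positivity)]
  nlinarith

/-- The factors of the exponential supermartingale for `m` successes in `n` Bernoulli trials: the
likelihood ratio of the empirical law. When `p` is `0` or `1`, an outcome of probability zero was
observed, and its factor can be chosen arbitrarily large. -/
theorem exists_likelihood_ratio {p L : ℝ} (hp₀ : 0 ≤ p) (hp₁ : p ≤ 1) (hL : 0 < L) {n m : ℕ}
    (hmn : m ≤ n) (hn : 0 < n)
    (h : √(4 * ((m / n : ℝ) * (1 - m / n)) * L / n) + 14 * L / (3 * n) < |p - m / n|) :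
    ∃ a b : ℝ, 0 ≤ a ∧ 0 ≤ b ∧ p * a + (1 - p) * b ≤ 1 ∧
      Real.exp (2 * L) ≤ a ^ m * b ^ (n - m) := by
  have hn' : (0 : ℝ) < n := by exact_mod_cast hn
  have hpos : 0 < |p - m / n| := lt_of_le_of_lt (by positivity) h
  have h1 : (1 : ℝ) ≤ Real.exp (2 * L) := Real.one_le_exp (by linarith)
  rcases hp₀.eq_or_lt with rfl | hp₀
  · refine ⟨Real.exp (2 * L), 1, by positivity, by norm_num, by simp, ?_⟩
    have hm : m ≠ 0 := by
      rintro rfl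
      simp at hpos
    simpa using le_self_pow₀ h1 hm
  rcases hp₁.eq_or_lt with rfl | hp₁
  · refine ⟨1, Real.exp (2 * L), by norm_num, by positivity, by simp, ?_⟩
    have hm : n - m ≠ 0 := by
      intro h0
      obtain rfl : m = n := by omega
      rw [div_self hn'.ne'] at hpos
      simp at hpos
    simpa using le_self_pow₀ h1 hm
  have hx₀ : (0 : ℝ) ≤ m / n := by positivity
  have hx₁ : (m / n : ℝ) ≤ 1 := (div_le_one hn').2 (by exact_mod_cast hmn)
  have key := two_mul_le_klBernoulli hx₀ hx₁ hp₀ hp₁ hL hn' h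
  have hp1 : 0 < 1 - p := by linarith
  refine ⟨(m / n : ℝ) / p, (1 - (m / n : ℝ)) / (1 - p), by positivity,
    div_nonneg (by linarith) hp1.le, ?_, ?_⟩
  · rw [mul_div_cancel₀ _ hp₀.ne', mul_div_cancel₀ _ hp1.ne']
    linarith
  · -- at the exponent `0` both sides are `1`, whatever the base
    have hpow : ∀ (y : ℝ) (k : ℕ), (k = 0 ∨ 0 < y) → y ^ k = Real.exp (k * Real.log y) := by
      rintro y k (rfl | hy)
      · simp
      · rw [Real.exp_nat_mul, Real.exp_log hy]
    rw [hpow _ m, hpow _ (n - m), ← Real.exp_add]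
    · refine Real.exp_le_exp.2 (key.trans_eq ?_)
      rw [Nat.cast_sub hmn]
      field_simp
    · rcases hmn.eq_or_lt with rfl | hlt
      · left; simp
      · right
        have : (m / n : ℝ) < 1 := (div_lt_one hn').2 (by exact_mod_cast hlt)
        exact div_pos (by linarith) hp1
    · rcases Nat.eq_zero_or_pos m with h0 | h0
      · exact Or.inl h0
      · right
        positivity

/-! ### The logarithmic factor -/

section Log

variable [Nonempty S] [Nonempty A] {H K : ℕ} {δ : ℝ}

theorem two_mul_le_logFactor_arg (hH : 1 ≤ H) (hK : 1 ≤ K) (hδ₀ : 0 < δ) (hδ₁ : δ < 1) :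
    2 * (K : ℝ) ≤ 2 * Fintype.card S * Fintype.card A * H * K / δ := by
  have hS : (1 : ℝ) ≤ Fintype.card S := by exact_mod_cast Fintype.card_pos
  have hA : (1 : ℝ) ≤ Fintype.card A := by exact_mod_cast Fintype.card_pos
  have hH' : (1 : ℝ) ≤ H := by exact_mod_cast hH
  have hK' : (1 : ℝ) ≤ K := by exact_mod_cast hK
  rw [le_div_iff₀ hδ₀]
  have h1 : (1 : ℝ) ≤ Fintype.card S * Fintype.card A * H :=
    one_le_mul_of_one_le_of_one_le (one_le_mul_of_one_le_of_one_le hS hA) hH'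
  calc 2 * (K : ℝ) * δ ≤ 2 * K * 1 := by gcongr
    _ ≤ 2 * K * (Fintype.card S * Fintype.card A * H) := by gcongr
    _ = _ := by ring

theorem exp_neg_logFactor (hH : 1 ≤ H) (hK : 1 ≤ K) (hδ₀ : 0 < δ) :
    Real.exp (-logFactor S A H K δ) = δ / (2 * Fintype.card S * Fintype.card A * H * K) := by
  have hS : 0 < Fintype.card S := Fintype.card_pos
  have hA : 0 < Fintype.card A := Fintype.card_pos
  rw [logFactor, Real.exp_neg, Real.exp_log (by positivity), inv_div]

theorem log_two_mul_le_logFactor (hH : 1 ≤ H) (hK : 1 ≤ K) (hδ₀ : 0 < δ) (hδ₁ : δ < 1) :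
    Real.log (2 * K) ≤ logFactor S A H K δ :=
  Real.log_le_log (by positivity) (two_mul_le_logFactor_arg hH hK hδ₀ hδ₁)

theorem le_logFactor (hH : 1 ≤ H) (hK : 1 ≤ K) (hδ₀ : 0 < δ) (hδ₁ : δ < 1) :
    69 / 100 ≤ logFactor S A H K δ := by
  have hK' : (1 : ℝ) ≤ K := by exact_mod_cast hK
  have h1 : Real.log 2 ≤ Real.log (2 * K) := Real.log_le_log (by norm_num) (by linarith)
  linarith [Real.log_two_gt_d9, log_two_mul_le_logFactor (S := S) (A := A) hH hK hδ₀ hδ₁]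

end Log

/-! ### The true model stays in the confidence sets -/

theorem transitions_le_visits {H k : ℕ} (D : Fin k → Episode S A H) (s : S) (a : A) (s' : S) :
    transitions D s a s' ≤ visits D s a :=
  Finset.card_le_card fun p hp => by
    simp only [Finset.mem_filter, Finset.mem_univ, true_and] at hp ⊢
    exact ⟨hp.1, hp.2.1⟩

theorem visits_le {H k : ℕ} (D : Fin k → Episode S A H) (s : S) (a : A) :
    visits D s a ≤ H * k := by
  refine (Finset.card_filter_le _ _).trans_eq ?_
  simp [mul_comm]

theorem prod_transition_factor {H k : ℕ} (D : Fin k → Episode S A H) (s : S) (a : A) (s' : S)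
    (u v : ℝ) :
    ∏ i, ∏ h : Fin H, (if (D i).1 h.castSucc = s ∧ (D i).2 h = a then
      (if (D i).1 h.succ = s' then u else v) else 1) =
      u ^ transitions D s a s' * v ^ (visits D s a - transitions D s a s') := by
  have h1 : visits D s a = transitions D s a s' + (Finset.univ.filter fun p : Fin k × Fin H =>
      ((D p.1).1 p.2.castSucc = s ∧ (D p.1).2 p.2 = a) ∧ ¬ (D p.1).1 p.2.succ = s').card := by
    rw [visits, ← Finset.card_filter_add_card_filter_not
      (fun p : Fin k × Fin H => (D p.1).1 p.2.succ = s'), Finset.filter_filter,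
      Finset.filter_filter]
    simp only [transitions, and_assoc]
  rw [h1, Nat.add_sub_cancel_left, ← Fintype.prod_prod_type' (f := fun i h =>
    (if (D i).1 (Fin.castSucc h) = s ∧ (D i).2 h = a then
      (if (D i).1 h.succ = s' then u else v) else 1)), transitions, ← Finset.prod_const,
    ← Finset.prod_const, Finset.prod_filter, Finset.prod_filter, ← Finset.prod_mul_distrib]
  refine Finset.prod_congr rfl fun p _ => ?_
  by_cases h2 : (D p.1).1 p.2.castSucc = s <;> by_cases h3 : (D p.1).2 p.2 = a <;>
    by_cases h4 : (D p.1).1 p.2.succ = s' <;> simp [h2, h3, h4]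

section Concentration

variable {H : ℕ} (M : CMDP S A) (alg : LearningRule S A H)

/-- The counts `n` and `m` deviate from `P(s' | s, a)` by more than the confidence radius with
small probability, uniformly in the episode at which these counts are attained. -/
theorem probEvent_counts_le {L : ℝ} (hL : 0 < L) (K : ℕ) (s : S) (a : A) (s' : S) {n m : ℕ}
    (hmn : m ≤ n) (hn : 0 < n)
    (h : √(4 * ((m / n : ℝ) * (1 - m / n)) * L / n) + 14 * L / (3 * n) <
      |M.P s a s' - m / n|) :
    probEvent M alg {ω : Fin K → Episode S A H | ∃ k : Fin K,
      visits (past ω k) s a = n ∧ transitions (past ω k) s a s' = m} ≤ Real.exp (-L) ^ 2 := by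
  have hp₀ : 0 ≤ M.P s a s' := (M.P s a).2.1 s'
  have hp₁ := stdSimplex_apply_le_one (M.P s a) s'
  obtain ⟨u, v, hu, hv, huv, hexp⟩ := exists_likelihood_ratio hp₀ hp₁ hL hmn hn h
  set f : S → A → S → ℝ := fun x y z => if x = s ∧ y = a then (if z = s' then u else v) else 1
    with hf
  have hf₀ : ∀ x y z, 0 ≤ f x y z := by
    intro x y z
    simp only [hf]
    split_ifs <;> first | assumption | norm_num
  have hf₁ : ∀ x y, ∑ z, M.P x y z * f x y z ≤ 1 := by
    intro x y
    by_cases hxy : x = s ∧ y = a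
    · obtain ⟨rfl, rfl⟩ := hxy
      have h1 : ∀ z, M.P x y z * f x y z =
          v * M.P x y z + if z = s' then M.P x y z * (u - v) else 0 := by
        intro z
        simp only [hf, and_self, if_true]
        split_ifs <;> ring
      simp only [h1, Finset.sum_add_distrib, ← Finset.mul_sum, sum_stdSimplex,
        Finset.sum_ite_eq', Finset.mem_univ, if_true]
      linarith
    · simp [hf, hxy]
  have hville := probEvent_exists_le_pathProd M alg
    (fun _ _ x => ∏ h : Fin H, f (x.1 h.castSucc) (x.2 h) (x.1 h.succ))
    (fun _ _ x => Finset.prod_nonneg fun h _ => hf₀ _ _ _)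
    (fun k D => sum_episodeProb_mul_prod_le_one M.P f hf₁ hf₀ (alg k D) M.s₁)
    (Real.exp_pos (2 * L)) K
  have hc : 1 / Real.exp (2 * L) = Real.exp (-L) ^ 2 := by
    rw [one_div, ← Real.exp_neg, ← Real.exp_nat_mul]
    congr 1
    push_cast
    ring
  rw [← hc]
  refine (probEvent_mono M alg ?_).trans hville
  rintro ω ⟨k, hk₁, hk₂⟩
  refine ⟨k, hexp.trans_eq ?_⟩
  rw [pathProd, prod_transition_factor, hk₁, hk₂]

theorem probEvent_notMem_confidenceSet_le [Nonempty A] {K : ℕ} {δ : ℝ} (hH : 1 ≤ H) (hK : 1 ≤ K)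
    (hδ₀ : 0 < δ) (hδ₁ : δ < 1) :
    probEvent M alg {ω : Fin K → Episode S A H | ∃ k : Fin K,
      M.P ∉ confidenceSet (logFactor S A H K δ) (past ω k)} ≤ δ / 2 := by
  classical
  have : Nonempty S := ⟨M.s₁⟩
  have hL' := le_logFactor (S := S) (A := A) hH hK hδ₀ hδ₁
  have hexp := exp_neg_logFactor (S := S) (A := A) hH hK hδ₀
  set L := logFactor S A H K δ
  have hL : 0 < L := by linarith
  let t : Finset ((S × A × S) × ℕ × ℕ) :=
    Finset.univ ×ˢ (Finset.Icc 1 (H * K) ×ˢ Finset.range (H * K + 1))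
  let E : (S × A × S) × ℕ × ℕ → Set (Fin K → Episode S A H) := fun i => {ω |
    (√(4 * ((i.2.2 / i.2.1 : ℝ) * (1 - i.2.2 / i.2.1)) * L / i.2.1) + 14 * L / (3 * i.2.1) <
      |M.P i.1.1 i.1.2.1 i.1.2.2 - i.2.2 / i.2.1| ∧ i.2.2 ≤ i.2.1) ∧ ∃ k : Fin K,
      visits (past ω k) i.1.1 i.1.2.1 = i.2.1 ∧
        transitions (past ω k) i.1.1 i.1.2.1 i.1.2.2 = i.2.2}
  have hE : ∀ i ∈ t, probEvent M alg (E i) ≤ Real.exp (-L) ^ 2 := by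
    rintro ⟨⟨s, a, s'⟩, n, m⟩ hi
    have hn : 0 < n := by
      have := (Finset.mem_product.1 (Finset.mem_product.1 hi).2).1
      exact (Finset.mem_Icc.1 this).1
    by_cases hbad : (√(4 * ((m / n : ℝ) * (1 - m / n)) * L / n) + 14 * L / (3 * n) <
      |M.P s a s' - m / n| ∧ m ≤ n)
    · exact (probEvent_mono M alg fun ω hω => hω.2).trans
        (probEvent_counts_le M alg hL K s a s' hbad.2 hn hbad.1)
    · have : E ⟨⟨s, a, s'⟩, n, m⟩ = ∅ := by
        ext ω
        simp only [E, Set.mem_ofPred_eq, Set.mem_empty_iff_false, iff_false]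
        exact fun h => hbad h.1
      rw [this]
      simp only [probEvent, Set.indicator_empty, Finset.sum_const_zero]
      positivity
  have hsub : {ω : Fin K → Episode S A H | ∃ k : Fin K, M.P ∉ confidenceSet L (past ω k)} ⊆
      ⋃ i ∈ t, E i := by
    rintro ω ⟨k, hk⟩
    simp only [confidenceSet, Set.mem_ofPred_eq, not_forall, not_le] at hk
    obtain ⟨s, a, s', hk⟩ := hk
    have hle : visits (past ω k) s a ≤ H * K :=
      (visits_le _ s a).trans (Nat.mul_le_mul_left H k.isLt.le)
    have htr := transitions_le_visits (past ω k) s a s'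
    have hpos : 1 ≤ visits (past ω k) s a := by
      by_contra h0
      have h0 : visits (past ω k) s a = 0 := by omega
      have h1 : transitions (past ω k) s a s' = 0 := by omega
      simp only [beta, phat, h0, h1] at hk
      have hp₀ : 0 ≤ M.P s a s' := (M.P s a).2.1 s'
      have hp₁ := stdSimplex_apply_le_one (M.P s a) s'
      norm_num at hk
      rw [abs_of_nonneg hp₀] at hk
      linarith
    simp only [Set.mem_iUnion]
    refine ⟨⟨⟨s, a, s'⟩, visits (past ω k) s a, transitions (past ω k) s a s'⟩, ?_, ?_⟩
    · simp only [t, Finset.mem_product, Finset.mem_univ, true_and, Finset.mem_Icc,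
        Finset.mem_range]
      omega
    · refine ⟨⟨?_, htr⟩, k, rfl, rfl⟩
      have hmax : max (visits (past ω k) s a : ℝ) 1 = visits (past ω k) s a :=
        max_eq_left (by exact_mod_cast hpos)
      simpa only [beta, phat, hmax] using hk
  refine (probEvent_mono M alg hsub).trans ((probEvent_iUnion_le M alg t E hE).trans ?_)
  have hS : (1 : ℝ) ≤ Fintype.card S := by exact_mod_cast Fintype.card_pos
  have hA : (1 : ℝ) ≤ Fintype.card A := by exact_mod_cast Fintype.card_pos
  have hH' : (1 : ℝ) ≤ H := by exact_mod_cast hH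
  have hK' : (1 : ℝ) ≤ K := by exact_mod_cast hK
  have hcard : (t.card : ℝ) =
      Fintype.card S ^ 2 * Fintype.card A * (H * K * (H * K + 1)) := by
    simp only [t, Finset.card_product, Finset.card_univ, Fintype.card_prod, Nat.card_Icc,
      Finset.card_range]
    push_cast [Nat.add_sub_cancel]
    ring
  have hHK : (1 : ℝ) ≤ H * K := one_le_mul_of_one_le_of_one_le hH' hK'
  rw [hexp, hcard]
  have e : (Fintype.card S : ℝ) ^ 2 * Fintype.card A * (H * K * (H * K + 1)) *
      (δ / (2 * Fintype.card S * Fintype.card A * H * K)) ^ 2 =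
      δ / 4 * (δ * ((H * K + 1) / (Fintype.card A * (H * K)))) := by
    field_simp
    ring
  rw [e]
  have h2 : ((H : ℝ) * K + 1) / (Fintype.card A * (H * K)) ≤ 2 := by
    rw [div_le_iff₀ (by positivity)]
    nlinarith
  have h3 : δ * (((H : ℝ) * K + 1) / (Fintype.card A * (H * K))) ≤ 1 * 2 := by gcongr
  nlinarith

/-! ### Lower bounds for the visit counts -/

/-- The conditional expectation of the number of visits to `(s, a)`, summed over the episodes of
`D`, each of them conditioned on the previous ones. -/
noncomputable def expectedVisits {k : ℕ} (D : Fin k → Episode S A H) (s : S) (a : A) : ℝ :=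
  ∑ i : Fin k, occupancy (played alg D i) M.P M.s₁ s a

theorem visits_eq_sum {k : ℕ} (D : Fin k → Episode S A H) (s : S) (a : A) :
    (visits D s a : ℝ) = ∑ i, ∑ h : Fin H,
      if (D i).1 h.castSucc = s ∧ (D i).2 h = a then 1 else 0 := by
  rw [visits, Finset.card_filter, Fintype.sum_prod_type]
  push_cast
  rfl

theorem exp_neg_le_one_sub_half {y : ℝ} (h₀ : 0 ≤ y) (h₁ : y ≤ 1) :
    Real.exp (-y) ≤ 1 - y / 2 := by
  have h2 : 1 + y + y ^ 2 / 2 ≤ Real.exp y := Real.quadratic_le_exp_of_nonneg h₀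
  rw [Real.exp_neg, inv_le_comm₀ (Real.exp_pos y) (by linarith)]
  refine le_trans ?_ h2
  rw [inv_le_iff_one_le_mul₀ (by linarith)]
  nlinarith [mul_nonneg h₀ (sub_nonneg.2 h₁), mul_nonneg h₀ (mul_nonneg h₀ (sub_nonneg.2 h₁))]

theorem probEvent_visits_lt_le {L : ℝ} (hH : 1 ≤ H) (K : ℕ) (s : S) (a : A) :
    probEvent M alg {ω : Fin K → Episode S A H | ∃ k : Fin K,
      (visits (past ω k) s a : ℝ) < expectedVisits M alg (past ω k) s a / 2 - H * L} ≤
      Real.exp (-L) := by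
  have hH' : (0 : ℝ) < H := by exact_mod_cast hH
  let N : Episode S A H → ℝ := fun x =>
    ∑ h : Fin H, if x.1 h.castSucc = s ∧ x.2 h = a then 1 else 0
  have hN₀ : ∀ x, 0 ≤ N x := fun x => Finset.sum_nonneg fun h _ => by split_ifs <;> norm_num
  have hN₁ : ∀ x, N x / H ≤ 1 := by
    intro x
    rw [div_le_one hH']
    have : N x ≤ ∑ _h : Fin H, (1 : ℝ) :=
      Finset.sum_le_sum fun h _ => by split_ifs <;> norm_num
    simpa using this
  let F : (k : ℕ) → (Fin k → Episode S A H) → Episode S A H → ℝ := fun k D x =>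
    Real.exp (occupancy (alg k D) M.P M.s₁ s a / (2 * H)) * Real.exp (-(N x / H))
  have hF : ∀ k (D : Fin k → Episode S A H),
      ∑ x, episodeProb (alg k D) M.P M.s₁ x * F k D x ≤ 1 := by
    intro k D
    set q := occupancy (alg k D) M.P M.s₁ s a with hq
    have hsum : ∑ x, episodeProb (alg k D) M.P M.s₁ x * N x = q := rfl
    have h1 : ∑ x, episodeProb (alg k D) M.P M.s₁ x * Real.exp (-(N x / H)) ≤
        1 - q / (2 * H) := by
      calc _ ≤ ∑ x, episodeProb (alg k D) M.P M.s₁ x * (1 - N x / H / 2) :=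
            Finset.sum_le_sum fun x _ => mul_le_mul_of_nonneg_left
              (exp_neg_le_one_sub_half (div_nonneg (hN₀ x) hH'.le) (hN₁ x))
              (episodeProb_nonneg _ _ _ _)
        _ = ∑ x, episodeProb (alg k D) M.P M.s₁ x -
              (∑ x, episodeProb (alg k D) M.P M.s₁ x * N x) / (2 * H) := by
            rw [Finset.sum_div, ← Finset.sum_sub_distrib]
            exact Finset.sum_congr rfl fun x _ => by field_simp
        _ = _ := by rw [sum_episodeProb, hsum]
    have h2 : 1 - q / (2 * H) ≤ Real.exp (-(q / (2 * H))) := by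
      linarith [Real.add_one_le_exp (-(q / (2 * H)))]
    calc _ = Real.exp (q / (2 * H)) *
          ∑ x, episodeProb (alg k D) M.P M.s₁ x * Real.exp (-(N x / H)) := by
          rw [Finset.mul_sum]
          exact Finset.sum_congr rfl fun x _ => by simp only [F]; ring
      _ ≤ Real.exp (q / (2 * H)) * Real.exp (-(q / (2 * H))) :=
          mul_le_mul_of_nonneg_left (h1.trans h2) (Real.exp_pos _).le
      _ = 1 := by rw [← Real.exp_add, add_neg_cancel, Real.exp_zero]
  have hville := probEvent_exists_le_pathProd M alg F (fun k D x => by positivity) hF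
    (Real.exp_pos L) K
  rw [one_div, ← Real.exp_neg] at hville
  refine (probEvent_mono M alg ?_).trans hville
  rintro ω ⟨k, hk⟩
  refine ⟨k, ?_⟩
  have hprod : pathProd F (past ω k) =
      Real.exp (expectedVisits M alg (past ω k) s a / (2 * H) - visits (past ω k) s a / H) := by
    rw [pathProd, visits_eq_sum, expectedVisits, Finset.sum_div, Finset.sum_div,
      ← Finset.sum_sub_distrib, Real.exp_sum]
    refine Finset.prod_congr rfl fun i _ => ?_
    rw [sub_eq_add_neg, Real.exp_add]
    rfl
  rw [hprod, Real.exp_le_exp, div_sub_div _ _ (by positivity) (by positivity),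
    le_div_iff₀ (by positivity)]
  nlinarith

theorem probEvent_exists_visits_lt_le [Nonempty A] {K : ℕ} {δ : ℝ} (hH : 1 ≤ H) (hK : 1 ≤ K)
    (hδ₀ : 0 < δ) :
    probEvent M alg {ω : Fin K → Episode S A H | ∃ k : Fin K, ∃ s a,
      (visits (past ω k) s a : ℝ) <
        expectedVisits M alg (past ω k) s a / 2 - H * logFactor S A H K δ} ≤ δ / 2 := by
  have : Nonempty S := ⟨M.s₁⟩
  have h := probEvent_iUnion_le M alg (Finset.univ : Finset (S × A)) _
    fun i _ => probEvent_visits_lt_le M alg (L := logFactor S A H K δ) hH K i.1 i.2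
  refine (probEvent_mono M alg ?_).trans (h.trans ?_)
  · rintro ω ⟨k, s, a, hk⟩
    simp only [Set.mem_iUnion]
    exact ⟨(s, a), Finset.mem_univ _, k, hk⟩
  · have hS : (1 : ℝ) ≤ Fintype.card S := by exact_mod_cast Fintype.card_pos
    have hA : (1 : ℝ) ≤ Fintype.card A := by exact_mod_cast Fintype.card_pos
    have hH' : (1 : ℝ) ≤ H := by exact_mod_cast hH
    have hK' : (1 : ℝ) ≤ K := by exact_mod_cast hK
    rw [exp_neg_logFactor hH hK hδ₀, Finset.card_univ, Fintype.card_prod]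
    push_cast
    have e : (Fintype.card S : ℝ) * Fintype.card A *
        (δ / (2 * Fintype.card S * Fintype.card A * H * K)) = δ / 2 * (1 / (H * K)) := by
      field_simp
    rw [e]
    refine mul_le_of_le_one_right (by positivity) ?_
    rw [div_le_one (by positivity)]
    exact one_le_mul_of_one_le_of_one_le hH' hK'

end Concentration

/-! ### Size of the confidence radii -/

theorem sum_sqrt_le {ι : Type*} (t : Finset ι) {f : ι → ℝ} (hf : ∀ i ∈ t, 0 ≤ f i) :
    ∑ i ∈ t, √(f i) ≤ √(t.card * ∑ i ∈ t, f i) := by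
  apply Real.le_sqrt_of_sq_le
  refine sq_sum_le_card_mul_sum_sq.trans_eq ?_
  rw [Finset.sum_congr rfl fun i hi => Real.sq_sqrt (hf i hi)]

section Radius

variable {H k : ℕ} (D : Fin k → Episode S A H) (s : S) (a : A)

theorem sum_transitions : ∑ s', transitions D s a s' = visits D s a := by
  simp only [transitions, ← and_assoc, visits]
  rw [Finset.card_eq_sum_card_fiberwise (f := fun p : Fin k × Fin H => (D p.1).1 p.2.succ)
    (t := Finset.univ) fun _ _ => Finset.mem_univ _]
  simp only [Finset.filter_filter]

theorem phat_nonneg (s' : S) : 0 ≤ phat D s a s' := by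
  unfold phat
  positivity

theorem phat_le_one (s' : S) : phat D s a s' ≤ 1 := by
  unfold phat
  rw [div_le_one (by positivity)]
  exact le_max_of_le_left (by exact_mod_cast transitions_le_visits D s a s')

theorem sum_phat_le_one : ∑ s', phat D s a s' ≤ 1 := by
  unfold phat
  rw [← Finset.sum_div, div_le_one (by positivity)]
  exact le_max_of_le_left (by exact_mod_cast (sum_transitions D s a).le)

variable {L : ℝ}

theorem beta_nonneg (hL : 0 ≤ L) (s' : S) : 0 ≤ beta L D s a s' := by
  unfold beta
  positivity

theorem betaBar_nonneg (hL : 0 ≤ L) : 0 ≤ betaBar L D s a :=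
  Finset.sum_nonneg fun s' _ => beta_nonneg D s a hL s'

theorem betaBar_le (hL : 0 ≤ L) :
    betaBar L D s a ≤ √(4 * L * Fintype.card S / max (visits D s a : ℝ) 1) +
      14 * L * Fintype.card S / (3 * max (visits D s a : ℝ) 1) := by
  set N := max (visits D s a : ℝ) 1
  have hN : 0 < N := by positivity
  have hvar : ∀ s', 0 ≤ phat D s a s' * (1 - phat D s a s') := fun s' =>
    mul_nonneg (phat_nonneg D s a s') (sub_nonneg.2 (phat_le_one D s a s'))
  have hsum : ∑ s', phat D s a s' * (1 - phat D s a s') ≤ 1 :=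
    (Finset.sum_le_sum fun s' _ => mul_le_of_le_one_right (phat_nonneg D s a s')
      (by linarith [phat_nonneg D s a s'])).trans (sum_phat_le_one D s a)
  simp only [betaBar, beta, Finset.sum_add_distrib, Finset.sum_const, nsmul_eq_mul]
  refine add_le_add ((sum_sqrt_le _ fun s' _ => ?_).trans (Real.sqrt_le_sqrt ?_)) (le_of_eq ?_)
  · have := hvar s'
    positivity
  · have : ∑ s', 4 * (phat D s a s' * (1 - phat D s a s')) * L / N =
        4 * L / N * ∑ s', phat D s a s' * (1 - phat D s a s') := by
      rw [Finset.mul_sum]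
      exact Finset.sum_congr rfl fun _ _ => by ring
    rw [this, Finset.card_univ]
    calc _ ≤ (Fintype.card S : ℝ) * (4 * L / N * 1) := by gcongr
      _ = _ := by ring
  · rw [Finset.card_univ]
    ring

theorem betaBar_le_const [Nonempty S] (hL : 69 / 100 ≤ L) :
    betaBar L D s a ≤ 8 * L * Fintype.card S := by
  have hS : (1 : ℝ) ≤ Fintype.card S := by exact_mod_cast Fintype.card_pos
  refine (betaBar_le D s a (by linarith)).trans ?_
  have hN : 1 ≤ max (visits D s a : ℝ) 1 := le_max_right _ _
  have hLS : 69 / 100 ≤ L * Fintype.card S := by nlinarith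
  have h1 : √(4 * L * Fintype.card S / max (visits D s a : ℝ) 1) ≤ 3 * (L * Fintype.card S) := by
    rw [Real.sqrt_le_left (by positivity)]
    refine (div_le_self (by positivity) hN).trans ?_
    nlinarith
  have h2 : 14 * L * Fintype.card S / (3 * max (visits D s a : ℝ) 1) ≤
      14 / 3 * (L * Fintype.card S) := by
    rw [div_le_iff₀ (by positivity)]
    nlinarith
  linarith

/-- The size of the confidence radius in terms of a lower bound `W` for the expected number of
visits, once the latter dominates the fluctuations of the visit counts. -/
theorem betaBar_le_of_le_visits {W : ℝ} (hH : 1 ≤ H) (hL : 69 / 100 ≤ L)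
    (hW : W / 2 - H * L ≤ visits D s a) (hWL : 4 * H * L ≤ W) :
    betaBar L D s a ≤ √(24 * L * Fintype.card S) / √(W + H) +
      28 * L * Fintype.card S / (W + H) := by
  have hH' : (1 : ℝ) ≤ H := by exact_mod_cast hH
  refine (betaBar_le D s a (by linarith)).trans ?_
  have hHL : H * (69 / 100) ≤ H * L := by gcongr
  have hN : (W + H) / 6 ≤ max (visits D s a : ℝ) 1 :=
    le_trans (by linarith) ((hW).trans (le_max_left _ _))
  have hpos : 0 < W + H := by nlinarith
  rw [← Real.sqrt_div (by positivity)]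
  refine add_le_add (Real.sqrt_le_sqrt ?_) ?_
  · calc _ ≤ 4 * L * Fintype.card S / ((W + H) / 6) := by gcongr
      _ = _ := by field_simp; ring
  · calc _ ≤ 14 * L * Fintype.card S / (3 * ((W + H) / 6)) := by gcongr
      _ = _ := by field_simp; ring

end Radius

/-! ### Summation along an episode sequence -/

section Sequence

variable {Q : ℕ → ℝ} {B : ℝ}

theorem sum_div_sqrt_le (hB : 0 < B) (h₀ : ∀ k, 0 ≤ Q k) (h₁ : ∀ k, Q k ≤ B) (n : ℕ) :
    ∑ k ∈ Finset.range n, Q k / √(∑ i ∈ Finset.range k, Q i + B) ≤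
      2 * √(∑ i ∈ Finset.range n, Q i) := by
  induction n with
  | zero => simp
  | succ n ih =>
    rw [Finset.sum_range_succ, Finset.sum_range_succ (fun i => Q i)]
    have hW : 0 ≤ ∑ i ∈ Finset.range n, Q i := Finset.sum_nonneg fun i _ => h₀ i
    set W := ∑ i ∈ Finset.range n, Q i
    have hz : 0 < √(W + B) := Real.sqrt_pos.2 (by linarith)
    have hxy : √W ≤ √(W + Q n) := Real.sqrt_le_sqrt (by linarith [h₀ n])
    have hyz : √(W + Q n) ≤ √(W + B) := Real.sqrt_le_sqrt (by linarith [h₁ n])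
    have hx := Real.sq_sqrt hW
    have hy := Real.sq_sqrt (add_nonneg hW (h₀ n))
    have : Q n / √(W + B) ≤ 2 * (√(W + Q n) - √W) := by
      rw [div_le_iff₀ hz]
      nlinarith [mul_nonneg (sub_nonneg.2 hxy) (sub_nonneg.2 hyz),
        mul_nonneg (sub_nonneg.2 hxy) (sub_nonneg.2 (hxy.trans hyz))]
    linarith

theorem sum_div_le_log (hB : 0 < B) (h₀ : ∀ k, 0 ≤ Q k) (h₁ : ∀ k, Q k ≤ B) (n : ℕ) :
    ∑ k ∈ Finset.range n, Q k / (∑ i ∈ Finset.range k, Q i + B) ≤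
      2 * (Real.log (∑ i ∈ Finset.range n, Q i + B) - Real.log B) := by
  induction n with
  | zero => simp
  | succ n ih =>
    rw [Finset.sum_range_succ, Finset.sum_range_succ (fun i => Q i)]
    have hW : 0 ≤ ∑ i ∈ Finset.range n, Q i := Finset.sum_nonneg fun i _ => h₀ i
    set W := ∑ i ∈ Finset.range n, Q i
    have hpos : 0 < W + B := by linarith
    have hpos' : 0 < W + Q n + B := by linarith [h₀ n]
    have h2 := Real.one_sub_inv_le_log_of_pos (div_pos hpos' hpos)
    rw [Real.log_div hpos'.ne' hpos.ne', inv_div] at h2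
    have h3 : Q n / (W + B) ≤ 2 * (1 - (W + B) / (W + Q n + B)) := by
      have : 1 - (W + B) / (W + Q n + B) = Q n / (W + Q n + B) := by
        field_simp
        ring
      rw [this, ← mul_div_assoc, div_le_div_iff₀ hpos hpos']
      nlinarith [h₀ n, h₁ n, mul_nonneg (h₀ n) hW,
        mul_nonneg (h₀ n) (sub_nonneg.2 (h₁ n))]
    linarith

theorem sum_ite_lt_le {c : ℝ} (hc : 0 ≤ c) (hB : 0 ≤ B) (h₀ : ∀ k, 0 ≤ Q k) (h₁ : ∀ k, Q k ≤ B)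
    (n : ℕ) :
    ∑ k ∈ Finset.range n, (if ∑ i ∈ Finset.range k, Q i < c then Q k else 0) ≤ c + B := by
  suffices h : ∑ k ∈ Finset.range n, (if ∑ i ∈ Finset.range k, Q i < c then Q k else 0) ≤
      ∑ k ∈ Finset.range n, Q k ∧
      ∑ k ∈ Finset.range n, (if ∑ i ∈ Finset.range k, Q i < c then Q k else 0) ≤ c + B from h.2
  induction n with
  | zero => simpa using add_nonneg hc hB
  | succ n ih =>
    simp only [Finset.sum_range_succ]
    split_ifs with h
    · exact ⟨by linarith [ih.1], by linarith [ih.1, h₁ n]⟩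
    · exact ⟨by linarith [ih.1, h₀ n], by linarith [ih.2]⟩

end Sequence

/-! ### Safety and optimism of a solution of the OP problem -/

section OneEpisode

variable {H k : ℕ} (M : CMDP S A) {L : ℝ} (D : Fin k → Episode S A H)

theorem value_pessimisticCost (π : Policy S A H) (P : Model S A) (s : S) :
    value π P s (pessimisticCost M L D) =
      value π P s M.c + H * value π P s (betaBar L D) := by
  rw [← value_const_mul, ← value_add]
  rfl

theorem value_optimisticCost (π : Policy S A H) (P : Model S A) (s : S) (Cb : ℝ) :
    value π P s (optimisticCost M Cb L D) =
      value π P s M.r - (H : ℝ) ^ 2 / (M.Cbar - Cb) * value π P s (betaBar L D) := by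
  rw [sub_eq_add_neg, ← neg_mul, ← value_const_mul, ← value_add]
  congr 1
  funext s a
  rw [optimisticCost]
  ring

theorem isSafe_of_mem_opFeasible {π : Policy S A H} {P' : Model S A}
    (hP : M.P ∈ confidenceSet L D) (h : (π, P') ∈ opFeasible M L D) : IsSafe M π := by
  have := value_le_value_add_bonus hP h.1 zero_le_one (fun s a => (M.c_mem s a).1)
    (fun s a => (M.c_mem s a).2) (D := H) (by simp) π M.s₁
  exact this.trans h.2

/-- Optimism: the value of the OP problem is at most the optimal value of the constrained MDP.
The mixture of the baseline policy and the optimal policy with just enough weight on the former to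
be feasible has a smaller optimistic cost than the optimal policy. -/
theorem value_optimisticCost_le {q : Policy S A H × Model S A} {πb πstar : Policy S A H} {Cb : ℝ}
    (hL : 0 ≤ L) (hCb : value πb M.P M.s₁ M.c = Cb) (hΔ : Cb < M.Cbar)
    (hstar : IsSafe M πstar) (hq : IsOPSolution M Cb L D q)
    (hb : (πb, M.P) ∈ opFeasible M L D) :
    value q.1 q.2 M.s₁ (optimisticCost M Cb L D) ≤ value πstar M.P M.s₁ M.r := by
  have hβ : ∀ s a, 0 ≤ betaBar L D s a := fun s a => betaBar_nonneg D s a hL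
  have hfeas := hb.2
  simp only at hfeas
  rw [value_pessimisticCost, hCb] at hfeas
  have hb₀ := value_nonneg πb M.P M.s₁ hβ
  have he₀ := value_nonneg πstar M.P M.s₁ hβ
  have hr : value πb M.P M.s₁ M.r - value πstar M.P M.s₁ M.r ≤ H := by
    have h1 := value_le πb M.P M.s₁ (B := 1) fun s a => (M.r_mem s a).2
    have h2 := value_nonneg πstar M.P M.s₁ fun s a => (M.r_mem s a).1
    linarith
  unfold IsSafe at hstar
  set b := value πb M.P M.s₁ (betaBar L D)
  set e := value πstar M.P M.s₁ (betaBar L D)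
  have hΔ' : 0 < M.Cbar - Cb := sub_pos.2 hΔ
  set Δ := M.Cbar - Cb with hΔdef
  have hσ₀ : 0 ≤ Δ - H * b := by linarith
  have hHe : 0 ≤ H * e := by positivity
  have hH : (0 : ℝ) ≤ H := Nat.cast_nonneg H
  -- the mixture weight solves `γ H e = (1 - γ) (Δ - H b)`
  obtain ⟨γ, hγ₀, hγ₁, hγ⟩ : ∃ γ : ℝ, 0 ≤ γ ∧ γ ≤ 1 ∧ γ * (H * e) = (1 - γ) * (Δ - H * b) := by
    rcases (add_nonneg hσ₀ hHe).eq_or_lt with h | h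
    · exact ⟨1, zero_le_one, le_rfl, by nlinarith⟩
    · refine ⟨(Δ - H * b) / (Δ - H * b + H * e), div_nonneg hσ₀ h.le,
        (div_le_one h).2 (by linarith), ?_⟩
      field_simp
      ring
  obtain ⟨π, hπ⟩ := exists_policy_value_eq M.P M.s₁ πb πstar hγ₀ hγ₁
  have hmem : (π, M.P) ∈ opFeasible M L D := by
    refine ⟨hb.1, ?_⟩
    simp only
    rw [value_pessimisticCost, hπ, hπ, hCb]
    nlinarith
  refine (hq.2 _ hmem).trans ?_
  simp only
  rw [value_optimisticCost, hπ, hπ]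
  have hid : (H : ℝ) ^ 2 / Δ * ((1 - γ) * b + γ * e) = (1 - γ) * H := by
    rw [div_mul_eq_mul_div, div_eq_iff hΔ'.ne']
    linear_combination (H : ℝ) * hγ
  rw [hid]
  nlinarith

/-- The regret of one episode is at most the expected sum of the confidence radii under the true
model, up to a factor. -/
theorem value_sub_value_le [Nonempty S] {q : Policy S A H × Model S A}
    {πb πstar : Policy S A H} {Cb : ℝ} (hH : 1 ≤ H) (hL : 69 / 100 ≤ L)
    (hCb : value πb M.P M.s₁ M.c = Cb) (hΔ : Cb < M.Cbar) (hΔH : M.Cbar - Cb ≤ H)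
    (hstar : IsSafe M πstar) (hq : IsOPSolution M Cb L D q)
    (hb : (πb, M.P) ∈ opFeasible M L D) :
    value q.1 M.P M.s₁ M.r - value πstar M.P M.s₁ M.r ≤
      20 * (H : ℝ) ^ 3 * L * Fintype.card S / (M.Cbar - Cb) *
        value q.1 M.P M.s₁ (betaBar L D) := by
  have hβ : ∀ s a, 0 ≤ betaBar L D s a := fun s a => betaBar_nonneg D s a (by linarith)
  have hopt := value_optimisticCost_le M D (by linarith) hCb hΔ hstar hq hb
  rw [value_optimisticCost] at hopt
  have hS : (1 : ℝ) ≤ Fintype.card S := by exact_mod_cast Fintype.card_pos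
  have hH' : (1 : ℝ) ≤ H := by exact_mod_cast hH
  have hsim : value q.1 M.P M.s₁ M.r ≤
      value q.1 q.2 M.s₁ M.r + H * value q.1 q.2 M.s₁ (betaBar L D) := by
    rw [← value_const_mul, ← value_add]
    exact value_le_value_add_bonus hb.1 hq.1.1 zero_le_one (fun s a => (M.r_mem s a).1)
      (fun s a => (M.r_mem s a).2) (D := H) (by simp) q.1 M.s₁
  have hsimβ : value q.1 q.2 M.s₁ (betaBar L D) ≤ value q.1 M.P M.s₁ (betaBar L D) +
      H * (8 * L * Fintype.card S) * value q.1 M.P M.s₁ (betaBar L D) := by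
    rw [← value_const_mul, ← value_add]
    exact value_le_value_add_bonus hq.1.1 hb.1 (by positivity) hβ
      (fun s a => betaBar_le_const D s a hL) le_rfl q.1 M.s₁
  have hX := value_nonneg q.1 M.P M.s₁ hβ
  set X := value q.1 M.P M.s₁ (betaBar L D)
  set Y := value q.1 q.2 M.s₁ (betaBar L D)
  have hΔ' : 0 < M.Cbar - Cb := sub_pos.2 hΔ
  set Δ := M.Cbar - Cb
  have h1 : (H : ℝ) ≤ H ^ 2 / Δ := by
    rw [le_div_iff₀ hΔ']
    nlinarith
  have h2 : Y ≤ 10 * (H * L * Fintype.card S) * X := by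
    have : 69 / 100 ≤ H * L * Fintype.card S := by
      have : L ≤ H * L := le_mul_of_one_le_left (by linarith) hH'
      nlinarith
    nlinarith
  have hY : 0 ≤ Y := value_nonneg q.1 q.2 M.s₁ hβ
  calc _ ≤ H * Y + H ^ 2 / Δ * Y := by linarith
    _ ≤ H ^ 2 / Δ * Y + H ^ 2 / Δ * Y := by gcongr
    _ = 2 * (H ^ 2 / Δ) * Y := by ring
    _ ≤ 2 * (H ^ 2 / Δ) * (10 * (H * L * Fintype.card S) * X) := by gcongr
    _ = _ := by ring

end OneEpisode

/-! ### The good event -/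

section Good

variable {H : ℕ} (M : CMDP S A) (alg : LearningRule S A H)

/-- The event that, before every episode, the true model lies in the confidence set and all visit
counts are at least half of their conditional expectations, up to an additive term. -/
def goodEvent (K : ℕ) (δ : ℝ) : Set (Fin K → Episode S A H) :=
  {ω | ∀ k : Fin K, M.P ∈ confidenceSet (logFactor S A H K δ) (past ω k) ∧ ∀ s a,
    expectedVisits M alg (past ω k) s a / 2 - H * logFactor S A H K δ ≤ visits (past ω k) s a}

theorem probEvent_compl_goodEvent_le [Nonempty A] {K : ℕ} {δ : ℝ} (hH : 1 ≤ H) (hK : 1 ≤ K)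
    (hδ₀ : 0 < δ) (hδ₁ : δ < 1) : probEvent M alg (goodEvent M alg K δ)ᶜ ≤ δ := by
  have h1 := probEvent_notMem_confidenceSet_le M alg hH hK hδ₀ hδ₁
  have h2 := probEvent_exists_visits_lt_le M alg hH hK hδ₀
  refine (probEvent_mono M alg ?_).trans ((probEvent_union_le M alg _ _).trans
    ((add_le_add h1 h2).trans_eq (add_halves δ)))
  intro ω hω
  simp only [goodEvent, Set.mem_compl_iff, Set.mem_ofPred_eq, not_forall, not_and_or,
    not_le] at hω
  obtain ⟨k, hk | ⟨s, a, hk⟩⟩ := hω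
  · exact Or.inl ⟨k, hk⟩
  · exact Or.inr ⟨k, s, a, hk⟩

/-- The expected number of visits to `(s, a)` in the episode with index `i` of the run `ω`, given
the previous episodes; zero after the last episode. -/
noncomputable def visitRate {K : ℕ} (ω : Fin K → Episode S A H) (s : S) (a : A) (i : ℕ) : ℝ :=
  if h : i < K then occupancy (played alg ω ⟨i, h⟩) M.P M.s₁ s a else 0

theorem visitRate_coe {K : ℕ} (ω : Fin K → Episode S A H) (s : S) (a : A) (k : Fin K) :
    visitRate M alg ω s a k = occupancy (played alg ω k) M.P M.s₁ s a :=
  dif_pos k.isLt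

theorem visitRate_nonneg {K : ℕ} (ω : Fin K → Episode S A H) (s : S) (a : A) (i : ℕ) :
    0 ≤ visitRate M alg ω s a i := by
  unfold visitRate
  split_ifs
  · exact occupancy_nonneg _ _ _ _ _
  · exact le_rfl

theorem visitRate_le {K : ℕ} (ω : Fin K → Episode S A H) (s : S) (a : A) (i : ℕ) :
    visitRate M alg ω s a i ≤ H := by
  unfold visitRate
  split_ifs
  · exact occupancy_le _ _ _ _ _
  · positivity

theorem expectedVisits_past {K : ℕ} (ω : Fin K → Episode S A H) (k : Fin K) (s : S) (a : A) :
    expectedVisits M alg (past ω k) s a =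
      ∑ i ∈ Finset.range k, visitRate M alg ω s a i := by
  rw [Finset.sum_range, expectedVisits]
  refine Finset.sum_congr rfl fun i _ => ?_
  exact (visitRate_coe M alg ω s a (Fin.castLE k.isLt.le i)).symm

theorem sum_visitRate {K : ℕ} (ω : Fin K → Episode S A H) :
    ∑ p : S × A, ∑ i ∈ Finset.range K, visitRate M alg ω p.1 p.2 i = H * K := by
  rw [Finset.sum_comm, Finset.sum_range]
  have h : ∀ k : Fin K, ∑ p : S × A, visitRate M alg ω p.1 p.2 k = H := by
    intro k
    simp only [visitRate_coe]
    rw [Fintype.sum_prod_type]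
    exact sum_occupancy _ _ _
  simp [h, mul_comm]

/-! ### Feasibility of the baseline policy -/

/-- The baseline phase makes the bonus of the baseline policy as small as its slack. The pairs
`(s, a)` visited often by the baseline policy are summed by the Cauchy–Schwarz inequality, the
others contribute a term of lower order. -/
theorem value_betaBar_baseline_le [Nonempty A] {K : ℕ} {δ Cb : ℝ} {Ko : ℕ} {πb : Policy S A H}
    (hH : 1 ≤ H) (hK : 1 ≤ K) (hδ₀ : 0 < δ) (hδ₁ : δ < 1) (hΔ : Cb < M.Cbar)
    (hΔH : M.Cbar - Cb ≤ H)
    (hKo : 1000 * logFactor S A H K δ ^ 2 * baselineScale S A H (M.Cbar - Cb) ≤ Ko)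
    (halg : IsOPSRL M K δ πb Cb Ko alg) {ω : Fin K → Episode S A H}
    (hω : ω ∈ goodEvent M alg K δ) {k : Fin K} (hk : Ko ≤ (k : ℕ) + 1) :
    H * value πb M.P M.s₁ (betaBar (logFactor S A H K δ) (past ω k)) ≤ M.Cbar - Cb := by
  have : Nonempty S := ⟨M.s₁⟩
  have hL := le_logFactor (S := S) (A := A) hH hK hδ₀ hδ₁
  obtain ⟨-, hvis⟩ := hω k
  set L := logFactor S A H K δ
  have hS : (1 : ℝ) ≤ Fintype.card S := by exact_mod_cast Fintype.card_pos
  have hA : (1 : ℝ) ≤ Fintype.card A := by exact_mod_cast Fintype.card_pos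
  have hH' : (1 : ℝ) ≤ H := by exact_mod_cast hH
  have hΔ' : 0 < M.Cbar - Cb := sub_pos.2 hΔ
  unfold baselineScale at hKo
  set Δ := M.Cbar - Cb
  -- the number of completed baseline episodes
  set m : ℝ := ((Ko - 1 : ℕ) : ℝ) with hm
  have hscale : (1 : ℝ) ≤ (Fintype.card S : ℝ) ^ 2 * Fintype.card A * (H : ℝ) ^ 3 / Δ ^ 2 := by
    rw [one_le_div (by positivity)]
    calc Δ ^ 2 ≤ (H : ℝ) ^ 2 := by gcongr
      _ = 1 ^ 2 * 1 * ((H : ℝ) ^ 2 * 1) := by ring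
      _ ≤ (Fintype.card S : ℝ) ^ 2 * Fintype.card A * ((H : ℝ) ^ 2 * H) := by gcongr
      _ = _ := by ring
  have hL2 : 4 / 10 ≤ L ^ 2 := by nlinarith
  have hKo2 : (2 : ℝ) ≤ Ko := by
    have : (400 : ℝ) * 1 ≤ 1000 * L ^ 2 *
        ((Fintype.card S : ℝ) ^ 2 * Fintype.card A * (H : ℝ) ^ 3 / Δ ^ 2) :=
      mul_le_mul (by linarith) hscale (by norm_num) (by positivity)
    linarith
  have hKo1 : 1 ≤ Ko := by
    have : 2 ≤ Ko := by exact_mod_cast hKo2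
    omega
  have hmKo : (Ko : ℝ) / 2 ≤ m := by
    rw [hm, Nat.cast_sub hKo1]
    push_cast
    linarith
  have hm500 : 500 * L ^ 2 * ((Fintype.card S : ℝ) ^ 2 * Fintype.card A * (H : ℝ) ^ 3) ≤
      m * Δ ^ 2 := by
    rw [← mul_div_assoc, div_le_iff₀ (by positivity)] at hKo
    nlinarith [mul_le_mul_of_nonneg_right hmKo (sq_nonneg Δ)]
  have hm0 : 0 < m := by linarith
  have hW : ∀ s a, m * occupancy πb M.P M.s₁ s a ≤ expectedVisits M alg (past ω k) s a := by
    intro s a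
    rw [expectedVisits_past]
    calc _ = ∑ i ∈ Finset.range (Ko - 1), visitRate M alg ω s a i := by
          rw [Finset.sum_congr rfl fun i hi => ?_, Finset.sum_const, Finset.card_range,
            nsmul_eq_mul]
          have hi' := Finset.mem_range.1 hi
          have hiK : i < K := by have := k.isLt; omega
          rw [visitRate, dif_pos hiK, played, (halg i hiK _).1 (by omega)]
      _ ≤ _ := Finset.sum_le_sum_of_subset_of_nonneg
          (Finset.range_subset_range.2 (by omega)) fun i _ _ => visitRate_nonneg M alg ω s a i
  have hpt : ∀ p : S × A,
      occupancy πb M.P M.s₁ p.1 p.2 * betaBar L (past ω k) p.1 p.2 ≤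
        √(24 * L * Fintype.card S / m * occupancy πb M.P M.s₁ p.1 p.2) +
          73 * H * L ^ 2 * Fintype.card S / m := by
    rintro ⟨s, a⟩
    have hWsa := hW s a
    have hq := occupancy_nonneg πb M.P M.s₁ s a
    simp only
    set q := occupancy πb M.P M.s₁ s a
    rcases le_or_gt (4 * H * L) (expectedVisits M alg (past ω k) s a) with hc | hc
    · have h1 := betaBar_le_of_le_visits (past ω k) s a hH hL (hvis s a) hc
      set W := expectedVisits M alg (past ω k) s a
      have hWH : 0 < W + H := by nlinarith
      have h2 : q / (W + H) ≤ 1 / m := by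
        rw [div_le_div_iff₀ hWH hm0]
        linarith
      have h3 : q * (√(24 * L * Fintype.card S) / √(W + H)) ≤
          √(24 * L * Fintype.card S / m * q) := by
        rw [← Real.sqrt_div (by positivity)]
        apply Real.le_sqrt_of_sq_le
        rw [mul_pow, Real.sq_sqrt (by positivity)]
        calc _ = 24 * L * Fintype.card S * q * (q / (W + H)) := by ring
          _ ≤ 24 * L * Fintype.card S * q * (1 / m) := by gcongr
          _ = _ := by ring
      have h4 : q * (28 * L * Fintype.card S / (W + H)) ≤
          73 * H * L ^ 2 * Fintype.card S / m := by
        calc _ = 28 * (L * Fintype.card S * 1 * (q / (W + H))) := by ring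
          _ ≤ 28 * (L * Fintype.card S * (H * (L * 2)) * (1 / m)) := by
              gcongr
              exact one_le_mul_of_one_le_of_one_le hH' (by linarith)
          _ = 56 * (H * L ^ 2 * Fintype.card S / m) := by ring
          _ ≤ 73 * (H * L ^ 2 * Fintype.card S / m) := by gcongr; norm_num
          _ = _ := by ring
      calc _ ≤ q * (√(24 * L * Fintype.card S) / √(W + H) +
            28 * L * Fintype.card S / (W + H)) := by gcongr
        _ ≤ _ := by linarith
    · have h1 : q ≤ 4 * H * L / m := by
        rw [le_div_iff₀ hm0]
        linarith
      have h2 := betaBar_le_const (past ω k) s a hL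
      have h3 := betaBar_nonneg (past ω k) s a (show 0 ≤ L by linarith)
      calc _ ≤ 4 * H * L / m * (8 * L * Fintype.card S) := by
            gcongr
        _ = 32 * (H * L ^ 2 * Fintype.card S / m) := by ring
        _ ≤ 73 * (H * L ^ 2 * Fintype.card S / m) := by gcongr; norm_num
        _ = 73 * H * L ^ 2 * Fintype.card S / m := by ring
        _ ≤ _ := le_add_of_nonneg_left (Real.sqrt_nonneg _)
  have hsum : value πb M.P M.s₁ (betaBar L (past ω k)) ≤
      √(24 * L * Fintype.card S ^ 2 * Fintype.card A * H / m) +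
        73 * H * L ^ 2 * Fintype.card S ^ 2 * Fintype.card A / m := by
    rw [value_eq_sum_occupancy, ← Fintype.sum_prod_type'
      (f := fun s a => occupancy πb M.P M.s₁ s a * betaBar L (past ω k) s a)]
    refine (Finset.sum_le_sum fun p _ => hpt p).trans ?_
    rw [Finset.sum_add_distrib]
    refine add_le_add ((sum_sqrt_le _ fun p _ => ?_).trans_eq ?_) (le_of_eq ?_)
    · have := occupancy_nonneg πb M.P M.s₁ p.1 p.2
      positivity
    · rw [← Finset.mul_sum, Fintype.sum_prod_type, sum_occupancy, Finset.card_univ,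
        Fintype.card_prod]
      congr 1
      push_cast
      ring
    · rw [Finset.sum_const, Finset.card_univ, Fintype.card_prod, nsmul_eq_mul]
      push_cast
      ring
  have h1 : H * √(24 * L * Fintype.card S ^ 2 * Fintype.card A * H / m) ≤ Δ / 2 := by
    rw [← Real.sqrt_sq (show (0 : ℝ) ≤ H by positivity), ← Real.sqrt_mul (by positivity),
      Real.sqrt_le_left (by positivity), Real.sqrt_sq (by positivity), ← mul_div_assoc,
      div_le_iff₀ hm0]
    have : 24 * (L * (Fintype.card S ^ 2 * Fintype.card A * H ^ 3)) ≤
        125 * L * (L * (Fintype.card S ^ 2 * Fintype.card A * H ^ 3)) := by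
      gcongr
      linarith
    linarith
  have h2 : H * (73 * H * L ^ 2 * Fintype.card S ^ 2 * Fintype.card A / m) ≤ Δ / 2 := by
    rw [← mul_div_assoc, div_le_iff₀ hm0]
    have h3 : m * Δ ^ 2 ≤ m * Δ * H := by
      rw [pow_two, ← mul_assoc]
      gcongr
    have h4 : H * (500 * L ^ 2 * ((Fintype.card S : ℝ) ^ 2 * Fintype.card A * (H : ℝ) ^ 2)) ≤
        H * (m * Δ) := by linarith
    have h5 := le_of_mul_le_mul_left h4 (by linarith)
    have h6 : 0 ≤ L ^ 2 * ((Fintype.card S : ℝ) ^ 2 * Fintype.card A * (H : ℝ) ^ 2) := by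
      positivity
    linarith
  calc _ ≤ H * (√(24 * L * Fintype.card S ^ 2 * Fintype.card A * H / m) +
        73 * H * L ^ 2 * Fintype.card S ^ 2 * Fintype.card A / m) := by gcongr
    _ ≤ Δ := by linarith

/-! ### The regret bound -/

/-- The total size of the confidence radii along a run, measured under the true model. -/
theorem sum_value_betaBar_le [Nonempty A] {K : ℕ} {δ : ℝ}
    (hH : 1 ≤ H) (hK : 1 ≤ K) (hδ₀ : 0 < δ) (hδ₁ : δ < 1) {ω : Fin K → Episode S A H}
    (hω : ω ∈ goodEvent M alg K δ) :
    ∑ k : Fin K, value (played alg ω k) M.P M.s₁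
        (betaBar (logFactor S A H K δ) (past ω k)) ≤
      12 * logFactor S A H K δ * Fintype.card S * √(Fintype.card A * H * K) +
        100 * H * logFactor S A H K δ ^ 2 * Fintype.card S ^ 2 * Fintype.card A := by
  have : Nonempty S := ⟨M.s₁⟩
  have hL := le_logFactor (S := S) (A := A) hH hK hδ₀ hδ₁
  have hlogK := log_two_mul_le_logFactor (S := S) (A := A) hH hK hδ₀ hδ₁
  replace hω := fun k => (hω k).2
  set L := logFactor S A H K δ
  have hS : (1 : ℝ) ≤ Fintype.card S := by exact_mod_cast Fintype.card_pos
  have hH' : (1 : ℝ) ≤ H := by exact_mod_cast hH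
  have hK' : (1 : ℝ) ≤ K := by exact_mod_cast hK
  have hH0 : (0 : ℝ) < H := by linarith
  set σ : ℝ := (Fintype.card S : ℝ)
  have hpair : ∀ p : S × A, ∑ k : Fin K, occupancy (played alg ω k) M.P M.s₁ p.1 p.2 *
      betaBar L (past ω k) p.1 p.2 ≤
      2 * √(24 * L * σ) * √(∑ i ∈ Finset.range K, visitRate M alg ω p.1 p.2 i) +
        100 * H * L ^ 2 * σ := by
    rintro ⟨s, a⟩
    simp only
    set Q := visitRate M alg ω s a with hQ
    have hQ₀ : ∀ i, 0 ≤ Q i := visitRate_nonneg M alg ω s a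
    have hQ₁ : ∀ i, Q i ≤ H := visitRate_le M alg ω s a
    have hstep : ∀ k : Fin K, occupancy (played alg ω k) M.P M.s₁ s a *
        betaBar L (past ω k) s a ≤
        √(24 * L * σ) * (Q k / √(∑ i ∈ Finset.range k, Q i + H)) +
          28 * L * σ * (Q k / (∑ i ∈ Finset.range k, Q i + H)) +
          8 * L * σ * (if ∑ i ∈ Finset.range k, Q i < 4 * H * L then Q k else 0) := by
      intro k
      have hv := hω k s a
      rw [expectedVisits_past] at hv
      rw [← visitRate_coe, ← hQ]
      have hW : 0 ≤ ∑ i ∈ Finset.range k, Q i := Finset.sum_nonneg fun i _ => hQ₀ i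
      have hQk := hQ₀ k
      split_ifs with hc
      · have h1 := mul_le_mul_of_nonneg_left (betaBar_le_const (past ω k) s a hL) hQk
        have h2 : 0 ≤ √(24 * L * σ) * (Q k / √(∑ i ∈ Finset.range k, Q i + H)) := by positivity
        have h3 : 0 ≤ 28 * L * σ * (Q k / (∑ i ∈ Finset.range k, Q i + H)) := by positivity
        linarith
      · have h1 := mul_le_mul_of_nonneg_left
          (betaBar_le_of_le_visits (past ω k) s a hH hL hv (not_lt.1 hc)) hQk
        refine h1.trans_eq ?_
        ring
    refine (Finset.sum_le_sum fun k _ => hstep k).trans ?_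
    rw [Finset.sum_add_distrib, Finset.sum_add_distrib, ← Finset.mul_sum, ← Finset.mul_sum,
      ← Finset.mul_sum]
    have e1 := sum_div_sqrt_le hH0 hQ₀ hQ₁ K
    have e2 := sum_div_le_log hH0 hQ₀ hQ₁ K
    have e3 := sum_ite_lt_le (c := 4 * H * L) (by positivity) hH0.le hQ₀ hQ₁ K
    rw [Finset.sum_range] at e1 e2 e3
    have e4 : Real.log (∑ i ∈ Finset.range K, Q i + H) - Real.log H ≤ L := by
      have hW : 0 ≤ ∑ i ∈ Finset.range K, Q i := Finset.sum_nonneg fun i _ => hQ₀ i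
      have hW' : ∑ i ∈ Finset.range K, Q i ≤ K * H := by
        simpa using Finset.sum_le_sum fun i (_ : i ∈ Finset.range K) => hQ₁ i
      rw [← Real.log_div (by linarith) hH0.ne']
      refine (Real.log_le_log (by positivity) ?_).trans hlogK
      rw [div_le_iff₀ hH0]
      nlinarith
    have f1 := mul_le_mul_of_nonneg_left e1 (Real.sqrt_nonneg (24 * L * σ))
    have f2 := mul_le_mul_of_nonneg_left (e2.trans (mul_le_mul_of_nonneg_left e4 zero_le_two))
      (show 0 ≤ 28 * L * σ by positivity)
    have f3 := mul_le_mul_of_nonneg_left e3 (show 0 ≤ 8 * L * σ by positivity)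
    have f4 : 28 * L * σ * (2 * L) ≤ 56 * H * L ^ 2 * σ := by
      have : L ^ 2 * σ ≤ H * (L ^ 2 * σ) := le_mul_of_one_le_left (by positivity) hH'
      linarith
    have f5 : 8 * L * σ * (4 * H * L + H) ≤ 44 * H * L ^ 2 * σ := by
      have : H * L * σ * 1 ≤ H * L * σ * (3 / 2 * L) := by
        gcongr
        linarith
      linarith
    linarith
  simp only [value_eq_sum_occupancy]
  rw [Finset.sum_congr rfl fun k _ => (Fintype.sum_prod_type' (f := fun s a =>
    occupancy (played alg ω k) M.P M.s₁ s a * betaBar L (past ω k) s a)).symm, Finset.sum_comm]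
  refine (Finset.sum_le_sum fun p _ => hpair p).trans ?_
  rw [Finset.sum_add_distrib, ← Finset.mul_sum, Finset.sum_const, Finset.card_univ,
    Fintype.card_prod, nsmul_eq_mul]
  have hsq := sum_sqrt_le (Finset.univ : Finset (S × A))
    (f := fun p => ∑ i ∈ Finset.range K, visitRate M alg ω p.1 p.2 i)
    fun p _ => Finset.sum_nonneg fun i _ => visitRate_nonneg M alg ω p.1 p.2 i
  rw [sum_visitRate, Finset.card_univ, Fintype.card_prod] at hsq
  refine add_le_add ?_ (le_of_eq ?_)
  · have hroot : √(24 * L * σ) * √((Fintype.card S * Fintype.card A : ℕ) * (H * K)) ≤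
        6 * L * σ * √(Fintype.card A * H * K) := by
      rw [← Real.sqrt_mul (by positivity)]
      have e : 6 * L * σ * √(Fintype.card A * H * K) =
          √((6 * L * σ) ^ 2 * (Fintype.card A * H * K)) := by
        rw [Real.sqrt_mul (sq_nonneg _), Real.sqrt_sq (by positivity)]
      rw [e]
      apply Real.sqrt_le_sqrt
      have : 24 * L * (σ ^ 2 * (Fintype.card A * H * K)) ≤
          36 * L * L * (σ ^ 2 * (Fintype.card A * H * K)) := by
        gcongr
        nlinarith
      push_cast
      linarith
    calc _ ≤ 2 * √(24 * L * σ) * √((Fintype.card S * Fintype.card A : ℕ) * (H * K)) := by gcongr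
      _ = 2 * (√(24 * L * σ) * √((Fintype.card S * Fintype.card A : ℕ) * (H * K))) := by ring
      _ ≤ 2 * (6 * L * σ * √(Fintype.card A * H * K)) := by gcongr
      _ = _ := by ring
  · push_cast
    ring

theorem baseline_mem_opFeasible [Nonempty A] {K : ℕ} {δ Cb : ℝ} {Ko : ℕ} {πb : Policy S A H}
    (hH : 1 ≤ H) (hK : 1 ≤ K) (hδ₀ : 0 < δ) (hδ₁ : δ < 1)
    (hCb : value πb M.P M.s₁ M.c = Cb) (hΔ : Cb < M.Cbar) (hΔH : M.Cbar - Cb ≤ H)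
    (hKo : 1000 * logFactor S A H K δ ^ 2 * baselineScale S A H (M.Cbar - Cb) ≤ Ko)
    (halg : IsOPSRL M K δ πb Cb Ko alg) {ω : Fin K → Episode S A H}
    (hω : ω ∈ goodEvent M alg K δ) {k : Fin K} (hk : Ko ≤ (k : ℕ) + 1) :
    (πb, M.P) ∈ opFeasible M (logFactor S A H K δ) (past ω k) := by
  refine ⟨(hω k).1, ?_⟩
  simp only
  rw [value_pessimisticCost, hCb]
  linarith [value_betaBar_baseline_le M alg hH hK hδ₀ hδ₁ hΔ hΔH hKo halg hω hk]

theorem isSafe_played [Nonempty A] {K : ℕ} {δ Cb : ℝ} {Ko : ℕ} {πb : Policy S A H}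
    (hH : 1 ≤ H) (hK : 1 ≤ K) (hδ₀ : 0 < δ) (hδ₁ : δ < 1)
    (hCb : value πb M.P M.s₁ M.c = Cb) (hΔ : Cb < M.Cbar) (hΔH : M.Cbar - Cb ≤ H)
    (hKo : 1000 * logFactor S A H K δ ^ 2 * baselineScale S A H (M.Cbar - Cb) ≤ Ko)
    (halg : IsOPSRL M K δ πb Cb Ko alg) {ω : Fin K → Episode S A H}
    (hω : ω ∈ goodEvent M alg K δ) (k : Fin K) : IsSafe M (played alg ω k) := by
  rcases le_or_gt ((k : ℕ) + 1) Ko with hk | hk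
  · rw [played, (halg k k.isLt _).1 hk, IsSafe, hCb]
    exact hΔ.le
  · obtain ⟨P', hP'⟩ := (halg k k.isLt (past ω k)).2 hk
      ⟨_, baseline_mem_opFeasible M alg hH hK hδ₀ hδ₁ hCb hΔ hΔH hKo halg hω hk.le⟩
    exact isSafe_of_mem_opFeasible M (past ω k) (hω k).1 hP'.1

/-- Every baseline episode costs at most `H`; after them the regret is governed by the radii. -/
theorem regret_le [Nonempty A] {K : ℕ} {δ Cb : ℝ} {Ko : ℕ} {πb πstar : Policy S A H}
    (hH : 1 ≤ H) (hK : 1 ≤ K) (hδ₀ : 0 < δ) (hδ₁ : δ < 1)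
    (hCb : value πb M.P M.s₁ M.c = Cb) (hΔ : Cb < M.Cbar) (hΔH : M.Cbar - Cb ≤ H)
    (hstar : IsSafe M πstar)
    (hKo : 1000 * logFactor S A H K δ ^ 2 * baselineScale S A H (M.Cbar - Cb) ≤ Ko)
    (halg : IsOPSRL M K δ πb Cb Ko alg) {ω : Fin K → Episode S A H}
    (hω : ω ∈ goodEvent M alg K δ) :
    regret M πstar alg ω ≤ H * Ko + 400 * logFactor S A H K δ ^ 2 *
      ((Fintype.card S : ℝ) ^ 2 / (M.Cbar - Cb) * √(Fintype.card A * (H : ℝ) ^ 7 * K)) := by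
  have : Nonempty S := ⟨M.s₁⟩
  have hL := le_logFactor (S := S) (A := A) hH hK hδ₀ hδ₁
  have hX := sum_value_betaBar_le M alg hH hK hδ₀ hδ₁ hω
  have hfeas := fun k => baseline_mem_opFeasible M alg hH hK hδ₀ hδ₁ hCb hΔ hΔH hKo halg hω (k := k)
  have hS : (1 : ℝ) ≤ Fintype.card S := by exact_mod_cast Fintype.card_pos
  have hA : (1 : ℝ) ≤ Fintype.card A := by exact_mod_cast Fintype.card_pos
  have hH' : (1 : ℝ) ≤ H := by exact_mod_cast hH
  have hΔ' : 0 < M.Cbar - Cb := sub_pos.2 hΔ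
  have halg' := fun k : Fin K => halg k k.isLt (past ω k)
  set L := logFactor S A H K δ
  have hone : ∀ π : Policy S A H, value π M.P M.s₁ M.r - value πstar M.P M.s₁ M.r ≤ H := by
    intro π
    have h1 := value_le π M.P M.s₁ (B := 1) fun s a => (M.r_mem s a).2
    have h2 := value_nonneg πstar M.P M.s₁ fun s a => (M.r_mem s a).1
    linarith
  have hT : 0 ≤ (Fintype.card S : ℝ) ^ 2 / (M.Cbar - Cb) *
      √(Fintype.card A * (H : ℝ) ^ 7 * K) := by positivity
  rcases le_or_gt K Ko with hKKo | hKKo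
  · have h1 : regret M πstar alg ω ≤ ∑ _k : Fin K, (H : ℝ) :=
      Finset.sum_le_sum fun k _ => hone _
    have h2 : (K : ℝ) * H ≤ Ko * H := by gcongr
    have h3 : 0 ≤ 400 * L ^ 2 * ((Fintype.card S : ℝ) ^ 2 / (M.Cbar - Cb) *
      √(Fintype.card A * (H : ℝ) ^ 7 * K)) := by positivity
    simp only [Finset.sum_const, Finset.card_univ, Fintype.card_fin, nsmul_eq_mul] at h1
    linarith
  -- the factor of `value_sub_value_le`
  set G : ℝ := 20 * (H : ℝ) ^ 3 * L * Fintype.card S / (M.Cbar - Cb) with hG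
  have hstep : ∀ k : Fin K, value (played alg ω k) M.P M.s₁ M.r - value πstar M.P M.s₁ M.r ≤
      (if (k : ℕ) < Ko then (H : ℝ) else 0) +
        G * value (played alg ω k) M.P M.s₁ (betaBar L (past ω k)) := by
    intro k
    have hv := value_nonneg (played alg ω k) M.P M.s₁
      fun s a => betaBar_nonneg (past ω k) s a (show 0 ≤ L by linarith)
    split_ifs with hk
    · have : 0 ≤ G * value (played alg ω k) M.P M.s₁ (betaBar L (past ω k)) := by positivity
      linarith [hone (played alg ω k)]
    · have hb := hfeas k (by omega)
      obtain ⟨P', hP'⟩ := (halg' k).2 (by omega) ⟨_, hb⟩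
      rw [zero_add]
      exact value_sub_value_le M (past ω k) (q := (played alg ω k, P')) hH hL hCb hΔ hΔH hstar hP' hb
  have hbase : ∑ k : Fin K, (if (k : ℕ) < Ko then (H : ℝ) else 0) ≤ H * Ko := by
    rw [Fin.sum_univ_eq_sum_range (fun k => if k < Ko then (H : ℝ) else 0), ← Finset.sum_filter,
      Finset.sum_const, nsmul_eq_mul, mul_comm]
    gcongr
    calc _ ≤ (Finset.range Ko).card := Finset.card_le_card fun i hi =>
          Finset.mem_range.2 (Finset.mem_filter.1 hi).2
      _ = Ko := Finset.card_range Ko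
  have hreg : regret M πstar alg ω ≤ H * Ko + G *
      (12 * L * Fintype.card S * √(Fintype.card A * H * K) +
        100 * H * L ^ 2 * Fintype.card S ^ 2 * Fintype.card A) := by
    have hsum := Finset.sum_le_sum fun (k : Fin K) (_ : k ∈ Finset.univ) => hstep k
    rw [Finset.sum_add_distrib, ← Finset.mul_sum] at hsum
    refine le_trans hsum ?_
    exact add_le_add hbase (mul_le_mul_of_nonneg_left hX (by positivity))
  refine hreg.trans (add_le_add le_rfl ?_)
  set σ : ℝ := (Fintype.card S : ℝ)
  set α : ℝ := (Fintype.card A : ℝ)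
  have hKoK : (Ko : ℝ) ≤ K := by exact_mod_cast hKKo.le
  have hroot : √(α * (H : ℝ) ^ 7 * K) = H ^ 3 * √(α * H * K) := by
    rw [show α * (H : ℝ) ^ 7 * K = ((H : ℝ) ^ 3) ^ 2 * (α * H * K) by ring,
      Real.sqrt_mul (by positivity), Real.sqrt_sq (by positivity)]
  unfold baselineScale at hKo
  set Δ := M.Cbar - Cb
  -- after the baseline phase, the lower-order term is dominated by the leading one
  have hlow : 25 * L * σ * α * H ≤ √(α * H * K) := by
    apply Real.le_sqrt_of_sq_le
    have h1 : 1000 * L ^ 2 * (σ ^ 2 * α * H) ≤ K := by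
      refine le_trans ?_ (hKo.trans hKoK)
      gcongr
      rw [le_div_iff₀ (by positivity)]
      calc σ ^ 2 * α * H * Δ ^ 2 ≤ σ ^ 2 * α * H * (H : ℝ) ^ 2 := by gcongr
        _ = _ := by ring
    calc (25 * L * σ * α * H) ^ 2 = 625 * (α * H * (L ^ 2 * (σ ^ 2 * α * H))) := by ring
      _ ≤ 1000 * (α * H * (L ^ 2 * (σ ^ 2 * α * H))) := by gcongr; norm_num
      _ = α * H * (1000 * L ^ 2 * (σ ^ 2 * α * H)) := by ring
      _ ≤ α * H * K := by gcongr
  rw [hroot]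
  calc _ = G * (12 * L * σ * √(α * H * K) + 4 * L * σ * (25 * L * σ * α * H)) := by ring
    _ ≤ G * (12 * L * σ * √(α * H * K) + 4 * L * σ * √(α * H * K)) := by gcongr
    _ = 320 * (L ^ 2 * (σ ^ 2 / Δ * (H ^ 3 * √(α * H * K)))) := by
        rw [hG]
        ring
    _ ≤ 400 * (L ^ 2 * (σ ^ 2 / Δ * (H ^ 3 * √(α * H * K)))) := by gcongr; norm_num
    _ = _ := by ring

end Good

end OPSRL

theorem theorem1 :
    ∃ (c₀ : ℝ) (p₀ : ℕ), 0 < c₀ ∧ ∀ (c₁ : ℝ) (p₁ : ℕ), ∃ (C : ℝ) (q : ℕ), 0 < C ∧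
      ∀ (S A : Type*) [Fintype S] [Fintype A] [DecidableEq S] [DecidableEq A]
        (H K : ℕ) (M : OPSRL.CMDP S A) (δ : ℝ) (πb πstar : OPSRL.Policy S A H) (Cb : ℝ) (Ko : ℕ)
        (alg : OPSRL.LearningRule S A H),
        1 ≤ K →
        0 < δ → δ < 1 →
        OPSRL.value πb M.P M.s₁ M.c = Cb →
        Cb < M.Cbar →
        M.Cbar - Cb ≤ H →
        OPSRL.IsOptimalSafe M πstar →
        c₀ * OPSRL.logFactor S A H K δ ^ p₀ * OPSRL.baselineScale S A H (M.Cbar - Cb) ≤ Ko →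
        Ko ≤ c₁ * OPSRL.logFactor S A H K δ ^ p₁ * OPSRL.baselineScale S A H (M.Cbar - Cb) →
        OPSRL.IsOPSRL M K δ πb Cb Ko alg →
        ENNReal.ofReal (1 - 3 * δ) ≤ (OPSRL.runLaw M K alg).toOuterMeasure
          {ω | ∀ k : Fin K, Ko ≤ (k : ℕ) + 1 →
            (πb, M.P) ∈ OPSRL.opFeasible M (OPSRL.logFactor S A H K δ) (OPSRL.past ω k)} ∧
        ENNReal.ofReal (1 - 3 * δ) ≤ (OPSRL.runLaw M K alg).toOuterMeasure
          {ω | ∀ k : Fin K, OPSRL.IsSafe M (OPSRL.played alg ω k)} ∧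
        ENNReal.ofReal (1 - 3 * δ) ≤ (OPSRL.runLaw M K alg).toOuterMeasure
          {ω | OPSRL.regret M πstar alg ω ≤
            C * OPSRL.logFactor S A H K δ ^ q * OPSRL.regretScale S A H K (M.Cbar - Cb)} := by
  refine ⟨1000, 2, by norm_num, fun c₁ p₁ => ⟨4 * |c₁| + 400 * 2 ^ p₁, p₁ + 2, by positivity, ?_⟩⟩
  intro S A _ _ _ _ H K M δ πb πstar Cb Ko alg hK hδ₀ hδ₁ hCb hΔ hΔH hstar hKo hKo' halg
  have hH : 1 ≤ H := by
    rcases Nat.eq_zero_or_pos H with rfl | h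
    · simp at hΔH
      linarith
    · exact h
  have : Nonempty S := ⟨M.s₁⟩
  have : Nonempty A := by
    by_contra h
    rw [not_nonempty_iff] at h
    simpa using OPSRL.sum_stdSimplex (πb ⟨0, hH⟩ M.s₁)
  have hgood : OPSRL.probEvent M alg (OPSRL.goodEvent M alg K δ)ᶜ ≤ 3 * δ :=
    (OPSRL.probEvent_compl_goodEvent_le M alg hH hK hδ₀ hδ₁).trans (by linarith)
  refine ⟨OPSRL.ofReal_le_runLaw M alg hgood fun ω hω k hk =>
      OPSRL.baseline_mem_opFeasible M alg hH hK hδ₀ hδ₁ hCb hΔ hΔH hKo halg hω hk,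
    OPSRL.ofReal_le_runLaw M alg hgood fun ω hω k =>
      OPSRL.isSafe_played M alg hH hK hδ₀ hδ₁ hCb hΔ hΔH hKo halg hω k,
    OPSRL.ofReal_le_runLaw M alg hgood fun ω hω => ?_⟩
  refine (OPSRL.regret_le M alg hH hK hδ₀ hδ₁ hCb hΔ hΔH hstar.1 hKo halg hω).trans ?_
  have hL := OPSRL.le_logFactor (S := S) (A := A) hH hK hδ₀ hδ₁
  have hΔ' : 0 < M.Cbar - Cb := sub_pos.2 hΔ
  unfold OPSRL.regretScale
  unfold OPSRL.baselineScale at hKo'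
  set L := OPSRL.logFactor S A H K δ
  set Δ := M.Cbar - Cb
  set U : ℝ := (Fintype.card S : ℝ) ^ 2 * Fintype.card A * (H : ℝ) ^ 4 / Δ ^ 2 with hU
  set T : ℝ := (Fintype.card S : ℝ) ^ 2 / Δ * √(Fintype.card A * (H : ℝ) ^ 7 * K)
  have hU0 : 0 ≤ U := by positivity
  have hT0 : 0 ≤ T := by positivity
  have h1 : H * (Ko : ℝ) ≤ 4 * |c₁| * L ^ (p₁ + 2) * U := by
    calc H * (Ko : ℝ) ≤ H * (c₁ * L ^ p₁ *
          ((Fintype.card S : ℝ) ^ 2 * Fintype.card A * (H : ℝ) ^ 3 / Δ ^ 2)) := by gcongr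
      _ = c₁ * (L ^ p₁ * 1 * U) := by rw [hU]; ring
      _ ≤ |c₁| * (L ^ p₁ * (4 * L ^ 2) * U) := by
          gcongr
          · exact le_abs_self c₁
          · nlinarith
      _ = _ := by ring
  have h2 : 400 * L ^ 2 * T ≤ 400 * 2 ^ p₁ * L ^ (p₁ + 2) * T := by
    calc 400 * L ^ 2 * T = 400 * L ^ 2 * T * 1 := by ring
      _ ≤ 400 * L ^ 2 * T * (2 * L) ^ p₁ := by
          gcongr
          exact one_le_pow₀ (by linarith)
      _ = _ := by ring
  have h3 : 0 ≤ 4 * |c₁| * L ^ (p₁ + 2) * T := by positivity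
  have h4 : 0 ≤ 400 * 2 ^ p₁ * L ^ (p₁ + 2) * U := by positivity
  linarith
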